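/- For $n\in\mathbb{N}$ let $S_n$ be the set of permutations $\sigma=\sigma_1\cdots\sigma_n$ of $[n]=\{1,\dots,n\}$, written in one-line notation. A permutation $\sigma\in S_n$ contains the pattern $\eta\in S_m$ if there are $1\le i_1<\cdots<i_m\le n$ such that $\sigma_{i_a}<\sigma_{i_b}\iff\eta_a<\eta_b$ for all $a,b\in[m]$; otherwise $\sigma$ avoids $\eta$. Let $S_n^{\mathrm{av}(\eta)}$ be the set of permutations in $S_n$ that avoid $\eta$, and let $P_n^{\mathrm{av}(\eta)}$ and $E_n^{\mathrm{av}(\eta)}$ denote the uniform probability measure on it and the corresponding expectation. Let $C_n=\frac{1}{n+1}\binom{2n}{n}$ be the Catalan numbers. For $2\le k\le n$ and $\sigma\in S_n$, let $N_n^{(k)}(\sigma)$ be the number of pairs $(l,m)$ with $1\le l,m\le n-k+1$ and $\{\sigma_m,\dots,\sigma_{m+k-1}\}=\{l,\dots,l+k-1\}$. For $\tau\in S_k$, let $N_n^{(k;\tau)}(\sigma)$ be the number of those pairs for which moreover $\sigma_{m+i-1}=l-1+\tau_i$ for $i=1,\dots,k$. Let both numbers be $0$ if $n<k$. Theorem.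 Let $\eta\in\{132,213,231,312\}$ and $k\ge2$. Let $\tau^*(\eta)=k\,(k-1)\cdots1$ if $\eta\in\{231,312\}$ and $\tau^*(\eta)=1\,2\cdots k$ if $\eta\in\{132,213\}$. Then $\tau^*(\eta)\in S_k^{\mathrm{av}(\eta)}$, and the following hold. (i) For every $\tau\in S_k^{\mathrm{av}(\eta)}$ and every $n\ge k$, $$E_n^{\mathrm{av}(\eta)}N_n^{(k;\tau)}=\begin{cases}\dfrac{(n-k+2)\,C_{n-k+1}}{2C_n}&\text{if }\tau\ne\tau^*(\eta),\\[2ex]\dfrac{(n-k+3)\,C_{n-k+2}}{2C_n}-\dfrac{(n-k+2)\,C_{n-k+1}}{C_n}&\text{if }\tau=\tau^*(\eta).\end{cases}$$ Moreover, for every fixed $\tau\in S_k^{\mathrm{av}(\eta)}$, $N_n^{(k;\tau)}/E_n^{\mathrm{av}(\eta)}N_n^{(k;\tau)}\to1$ in probability as $n\to\infty$; that is, for every $\varepsilon>0$, $$\lim_{n\to\infty}P_n^{\mathrm{av}(\eta)}\left(\left|\frac{N_n^{(k;\tau)}}{E_n^{\mathrm{av}(\eta)}N_n^{(k;\tau)}}-1\right|\ge\varepsilon\right)=0.$$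 (ii) For every $n\ge k$, $$E_n^{\mathrm{av}(\eta)}N_n^{(k)}=\frac{C_{n-k+1}}{2C_n}\Big((n-k+2)\,C_k+n-k\Big),$$ and $N_n^{(k)}/E_n^{\mathrm{av}(\eta)}N_n^{(k)}\to1$ in probability as $n\to\infty$, in the same sense. -/

import Mathlib

/-!
Permutations of `[n] = {1, …, n}` are modelled by `Equiv.Perm (Fin n)`: position `i` and value `v` of the
one-line notation correspond to `i - 1` and `v - 1` in `Fin n`.
-/

namespace PatternClusters

open Filter Topology

/-- The permutation `132` in one-line notation. -/
def p132 : Equiv.Perm (Fin 3) := ⟨![0, 2, 1], ![0, 2, 1], by decide, by decide⟩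

/-- The permutation `213` in one-line notation. -/
def p213 : Equiv.Perm (Fin 3) := ⟨![1, 0, 2], ![1, 0, 2], by decide, by decide⟩

/-- The permutation `231` in one-line notation. -/
def p231 : Equiv.Perm (Fin 3) := ⟨![1, 2, 0], ![2, 0, 1], by decide, by decide⟩

/-- The permutation `312` in one-line notation. -/
def p312 : Equiv.Perm (Fin 3) := ⟨![2, 0, 1], ![1, 2, 0], by decide, by decide⟩

/-- `σ` contains `η` as a pattern: there are positions `f 0 < f 1 < ⋯` at which the entries of `σ` are in the
same relative order as the entries of `η`. -/
def ContainsPattern {m n : ℕ} (η : Equiv.Perm (Fin m)) (σ : Equiv.Perm (Fin n)) : Prop :=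
  ∃ f : Fin m → Fin n, StrictMono f ∧ ∀ i j : Fin m, σ (f i) < σ (f j) ↔ η i < η j

open Classical in
/-- The set of the permutations of `[n]` that avoid the pattern `η` (all of them if `n < m`). -/
noncomputable def avoiding {m : ℕ} (η : Equiv.Perm (Fin m)) (n : ℕ) : Finset (Equiv.Perm (Fin n)) :=
  Finset.univ.filter fun σ => ¬ ContainsPattern η σ

/-- Expectation of `X` under the uniform probability measure on the `η`-avoiding permutations of `[n]`. -/
noncomputable def expectation {m : ℕ} (η : Equiv.Perm (Fin m)) (n : ℕ) (X : Equiv.Perm (Fin n) → ℝ) : ℝ :=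
  (∑ σ ∈ avoiding η n, X σ) / ((avoiding η n).card : ℝ)

open Classical in
/-- Probability of the event `A` under the uniform probability measure on the `η`-avoiding permutations
of `[n]`. -/
noncomputable def prob {m : ℕ} (η : Equiv.Perm (Fin m)) (n : ℕ) (A : Equiv.Perm (Fin n) → Prop) : ℝ :=
  (((avoiding η n).filter A).card : ℝ) / ((avoiding η n).card : ℝ)

/-- The random variables `X n`, each on the `η`-avoiding permutations of `[n]` with the uniform
probability measure, converge in probability to the constant `c` as `n → ∞`. -/
def TendstoInProb {m : ℕ} (η : Equiv.Perm (Fin m)) (X : ∀ n : ℕ, Equiv.Perm (Fin n) → ℝ) (c : ℝ) : Prop :=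
  ∀ ε : ℝ, 0 < ε → Tendsto (fun n : ℕ => prob η n fun σ => ε ≤ |X n σ - c|) atTop (𝓝 0)

/-- The `k` consecutive values `l, …, l + k - 1` (counted from `0`) occupy in `σ`, in some order,
the `k` consecutive positions `s, …, s + k - 1`. -/
def IsCluster {n : ℕ} (k : ℕ) (σ : Equiv.Perm (Fin n)) (l s : ℕ) : Prop :=
  l + k ≤ n ∧ s + k ≤ n ∧
    (Finset.univ.filter fun p : Fin n => s ≤ (p : ℕ) ∧ (p : ℕ) < s + k).image σ =
      Finset.univ.filter fun v : Fin n => l ≤ (v : ℕ) ∧ (v : ℕ) < l + k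

/-- A cluster in which the values appear in the order given by `τ`. -/
def IsPatternCluster {n k : ℕ} (τ : Equiv.Perm (Fin k)) (σ : Equiv.Perm (Fin n)) (l s : ℕ) : Prop :=
  IsCluster k σ l s ∧
    ∀ (i : Fin k) (p : Fin n), (p : ℕ) = s + (i : ℕ) → ((σ p : Fin n) : ℕ) = l + ((τ i : Fin k) : ℕ)

open Classical in
/-- The number of occurrences in `σ` of `k` consecutive values in `k` consecutive positions. -/
noncomputable def numClusters {n : ℕ} (k : ℕ) (σ : Equiv.Perm (Fin n)) : ℕ :=
  ((Finset.range (n + 1) ×ˢ Finset.range (n + 1)).filter fun q => IsCluster k σ q.1 q.2).card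

open Classical in
/-- The number of occurrences in `σ` of `k` consecutive values in `k` consecutive positions whose order of
appearance is the pattern `τ`. -/
noncomputable def numPatternClusters {n k : ℕ} (τ : Equiv.Perm (Fin k)) (σ : Equiv.Perm (Fin n)) : ℕ :=
  ((Finset.range (n + 1) ×ˢ Finset.range (n + 1)).filter fun q => IsPatternCluster τ σ q.1 q.2).card

/-- The distinguished monotone pattern: decreasing, `k ⋯ 1`, for `231` and `312`, and
increasing, `1 ⋯ k`, otherwise (that is, for `132` and `213`). -/
def tauStar (η : Equiv.Perm (Fin 3)) (k : ℕ) : Equiv.Perm (Fin k) :=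
  if η = p231 ∨ η = p312 then Fin.revPerm else 1

end PatternClusters

/-! Splitting a 231-avoiding permutation at its maximum gives two smaller ones, the second lying
entirely above the first. Hence these permutations are binary trees (`treeVal`), and a cluster of
pattern `τ` is an occurrence of one tree `t` in another, `T`. An occurrence lies left of the root,
lies right of it, or covers it. The last kind is unique if it exists (`treeOcc_root_unique`), so
`treeCount t` is an additive functional with a 0/1 toll (`treeCount_node`).

Exact means: a covering occurrence aligns the root of `t` with that of `T`. In general this forces
`T` to be `t` with a tree planted at its leftmost leaf. If `t` is a right comb, that is, a
decreasing pattern, the rest of `T` may also hang from the lower end of the comb (`rootOcc_imp`). So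
with `m` extra nodes there are `catalan m` such trees, or `catalan (m + 1)` for a comb. The
resulting convolution recursion is solved in central binomial coefficients (`totalCount_of_ne`,
`totalCount_rightComb`).

Concentration: the mean is `c * n + O(1)`, so `treeCount t T - c * T.numNodes` is additive with
bounded toll and bounded mean. Its square obeys the same recursion. The dangerous cross term is a
product of means of independent subtrees, hence bounded, and comparison with the solution `4 ^ n`
bounds the second moment by `O(n ^ (3/2))` (`exists_sum_sq_le`). Chebyshev's inequality then gives
probability `O(n ^ (-1/2))`.

Reversal and complement carry the result from 231 to the other three patterns. Summing over the
finitely many `τ` gives the statements about all clusters. -/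

namespace PatternClusters

open BinaryTree Filter Topology

/-! ### Binary trees as 231-avoiding arrangements -/

/-- The one-line notation (positions and values counted from `0`) of the `231`-avoiding permutation
encoded by a binary tree: the root is the maximum, the left subtree encodes the entries before it and
the right subtree those after it, which are all larger than the ones before. -/
def treeVal : BinaryTree Unit → ℕ → ℕ
  | nil, _ => 0
  | node _ L R, i =>
    if i < L.numNodes then treeVal L i
    else if i = L.numNodes then L.numNodes + R.numNodes
    else L.numNodes + treeVal R (i - (L.numNodes + 1))

theorem treeVal_left {u : Unit} {L R : BinaryTree Unit} {i : ℕ} (h : i < L.numNodes) :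
    treeVal (node u L R) i = treeVal L i := by
  simp [treeVal, h]

theorem treeVal_root {u : Unit} {L R : BinaryTree Unit} :
    treeVal (node u L R) L.numNodes = L.numNodes + R.numNodes := by
  simp [treeVal]

theorem treeVal_right {u : Unit} {L R : BinaryTree Unit} (i : ℕ) :
    treeVal (node u L R) (L.numNodes + 1 + i) = L.numNodes + treeVal R i := by
  have h1 : ¬ L.numNodes + 1 + i < L.numNodes := by omega
  have h2 : ¬ L.numNodes + 1 + i = L.numNodes := by omega
  rw [treeVal, if_neg h1, if_neg h2, Nat.add_sub_cancel_left]

/-- A position in a node lies in the left subtree, at the root, or in the right subtree. -/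
theorem position_cases {L R : BinaryTree Unit} {i : ℕ} (h : i < L.numNodes + R.numNodes + 1) :
    i < L.numNodes ∨ i = L.numNodes ∨ ∃ j < R.numNodes, i = L.numNodes + 1 + j := by
  rcases lt_trichotomy i L.numNodes with h1 | h1 | h1
  · exact Or.inl h1
  · exact Or.inr (Or.inl h1)
  · exact Or.inr (Or.inr ⟨i - (L.numNodes + 1), by omega, by omega⟩)

theorem treeVal_lt (T : BinaryTree Unit) : ∀ i < T.numNodes, treeVal T i < T.numNodes := by
  induction T with
  | nil => intro i h; simp at h
  | node u L R hL hR =>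
    intro i h
    simp only [numNodes] at h ⊢
    rcases position_cases h with h | rfl | ⟨j, hj, rfl⟩
    · rw [treeVal_left h]; have := hL i h; omega
    · rw [treeVal_root]; omega
    · rw [treeVal_right]; have := hR j hj; omega

theorem treeVal_injOn (T : BinaryTree Unit) :
    ∀ i < T.numNodes, ∀ j < T.numNodes, treeVal T i = treeVal T j → i = j := by
  induction T with
  | nil => intro i h; simp at h
  | node u L R hL hR =>
    intro i hi j hj
    simp only [numNodes] at hi hj
    rcases position_cases hi with hi | rfl | ⟨i, hi', rfl⟩ <;>
    rcases position_cases hj with hj | rfl | ⟨j, hj', rfl⟩ <;>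
    simp only [treeVal_left, treeVal_root, treeVal_right, *] <;> intro h
    · exact hL i hi j hj h
    · have := treeVal_lt L i hi; omega
    · have := treeVal_lt L i hi; omega
    · have := treeVal_lt L j hj; omega
    · trivial
    · have := treeVal_lt R j hj'; omega
    · have := treeVal_lt L j hj; omega
    · have := treeVal_lt R i hi'; omega
    · rw [hR i hi' j hj' (by omega)]

theorem treeVal_avoids (T : BinaryTree Unit) :
    ∀ i j m, i < j → j < m → m < T.numNodes → treeVal T m < treeVal T i →
      ¬ treeVal T i < treeVal T j := by
  induction T with
  | nil => intro i j m _ _ h; simp at h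
  | node u L R hL hR =>
    intro i j m hij hjm hm
    have hj : j < L.numNodes + R.numNodes + 1 := hjm.trans hm
    have hi := hij.trans hj
    simp only [numNodes] at hm
    rcases position_cases hi with hi | rfl | ⟨i, hi', rfl⟩ <;>
    rcases position_cases hj with hj | rfl | ⟨j, hj', rfl⟩ <;>
    rcases position_cases hm with hm | rfl | ⟨m, hm', rfl⟩ <;>
    -- `omega` discards the placements that contradict `i < j < m`. With L, M, R for left, root,
    -- right there remain LLL, LLM, LLR, LMR, LRR, MRR, RRR; only LLL and RRR need induction.
    first
    | omega
    | skip
    · simp only [treeVal_left, *]; exact hL i j m hij hjm hm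
    · simp only [treeVal_left, treeVal_root, *]; have := treeVal_lt L i hi; omega
    · simp only [treeVal_left, treeVal_right, *]; have := treeVal_lt L i hi; omega
    · simp only [treeVal_left, treeVal_right, *]; have := treeVal_lt L i hi; omega
    · simp only [treeVal_left, treeVal_right, *]; have := treeVal_lt L i hi; omega
    · simp only [treeVal_right, treeVal_root]; have := treeVal_lt R j hj'; omega
    · simp only [treeVal_right]
      have := hR i j m (by omega) (by omega) hm'
      omega

/-- The position of the maximum, in terms of values. -/
theorem eq_root_of_treeVal_eq {u : Unit} {L R : BinaryTree Unit} {i : ℕ}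
    (hi : i < L.numNodes + R.numNodes + 1)
    (h : treeVal (node u L R) i = L.numNodes + R.numNodes) : i = L.numNodes :=
  treeVal_injOn (node u L R) i hi _ (by simp only [numNodes]; omega) (h.trans treeVal_root.symm)

/-- The position of the maximum reveals the size of the left subtree, and the entries on either side
of it then determine the subtrees recursively. -/
theorem eq_of_treeVal_eq (T : BinaryTree Unit) :
    ∀ T' : BinaryTree Unit, T.numNodes = T'.numNodes →
      (∀ i < T.numNodes, treeVal T i = treeVal T' i) → T = T' := by
  induction T with
  | nil =>
    intro T' h _
    cases T' with
    | nil => rfl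
    | node u L R => simp at h
  | node u L R hL hR =>
    intro T' h hv
    cases T' with
    | nil => simp at h
    | node u' L' R' =>
      simp only [numNodes] at h hv
      have e : L.numNodes = L'.numNodes := by
        refine eq_root_of_treeVal_eq (u := u') (R := R') (by omega) ?_
        rw [← hv _ (by omega), treeVal_root]; omega
      have eL : L = L' := hL L' e fun i hi => by
        have := hv i (by omega)
        rwa [treeVal_left hi, treeVal_left (e ▸ hi)] at this
      subst eL
      have eR : R = R' := hR R' (by omega) fun i hi => by
        have := hv (L.numNodes + 1 + i) (by omega)
        rw [treeVal_right, treeVal_right] at this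
        omega
      rw [eR]

theorem exists_treeVal_eq_zero (T : BinaryTree Unit) (hT : 0 < T.numNodes) :
    ∃ i < T.numNodes, treeVal T i = 0 := by
  induction T with
  | nil => simp at hT
  | node u L R hL hR =>
    rcases Nat.eq_zero_or_pos L.numNodes with h0 | h0
    · rcases Nat.eq_zero_or_pos R.numNodes with h1 | h1
      · exact ⟨L.numNodes, by simp only [numNodes]; omega, by rw [treeVal_root]; omega⟩
      · obtain ⟨i, hi, h⟩ := hR h1
        exact ⟨L.numNodes + 1 + i, by simp only [numNodes]; omega, by rw [treeVal_right]; omega⟩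
    · obtain ⟨i, hi, h⟩ := hL h0
      exact ⟨i, by simp only [numNodes]; omega, by rwa [treeVal_left hi]⟩

theorem exists_treeVal_eq_pred (T : BinaryTree Unit) (hT : 0 < T.numNodes) :
    ∃ i < T.numNodes, treeVal T i + 1 = T.numNodes := by
  cases T with
  | nil => simp at hT
  | node u L R =>
    exact ⟨L.numNodes, by simp only [numNodes]; omega, by rw [treeVal_root]; simp only [numNodes]⟩

/-- Every `231`-avoiding arrangement of `0, …, n - 1` comes from a binary tree. -/
theorem exists_tree_of_avoids (n : ℕ) : ∀ f : ℕ → ℕ, (∀ i < n, f i < n) →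
    (∀ i < n, ∀ j < n, f i = f j → i = j) →
    (∀ i j m, i < j → j < m → m < n → f m < f i → ¬ f i < f j) →
    ∃ T : BinaryTree Unit, T.numNodes = n ∧ ∀ i < n, f i = treeVal T i := by
  induction n using Nat.strong_induction_on with
  | _ n ih =>
    intro f hlt hinj hav
    rcases Nat.eq_zero_or_pos n with rfl | hn
    · exact ⟨nil, rfl, by simp⟩
    have hsurj : ∀ v < n, ∃ i < n, f i = v := by
      have h := Finset.surj_on_of_inj_on_of_card_le (s := Finset.range n) (t := Finset.range n)
        (fun i _ => f i) (by simpa using hlt)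
        (fun i j hi hj h => hinj i (by simpa using hi) j (by simpa using hj) h) le_rfl
      intro v hv
      obtain ⟨i, hi, h⟩ := h v (by simpa using hv)
      exact ⟨i, by simpa using hi, h.symm⟩
    obtain ⟨m, hm, hfm⟩ := hsurj (n - 1) (by omega)
    have hmax : ∀ i < n, i ≠ m → f i < n - 1 := fun i hi him => by
      have := hlt i hi
      have : f i ≠ f m := fun h => him (hinj i hi m hm h)
      omega
    -- The maximum at `m` would be the top of a 231 pattern if an entry before it exceeded one after
    -- it.
    have hLR : ∀ i < m, ∀ j, m < j → j < n → f i < f j := fun i hi j hj hjn => by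
      have h1 := hav i m j hi hj hjn
      have h2 := hmax i (by omega) (by omega)
      have h3 : f i ≠ f j := fun h => by have := hinj i (by omega) j hjn h; omega
      omega
    -- If `f i ≥ m`, the `f i + 1 > m` values up to `f i` would all have to sit at the `m` positions
    -- before `m`.
    have hL : ∀ i < m, f i < m := by
      intro i hi
      by_contra hcon
      have hsub : Finset.range (f i + 1) ⊆ (Finset.range m).image f := by
        intro v hv
        rw [Finset.mem_range] at hv
        obtain ⟨j, hj, rfl⟩ := hsurj v (by have := hlt i (by omega); omega)
        rw [Finset.mem_image]
        refine ⟨j, Finset.mem_range.2 ?_, rfl⟩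
        by_contra hjm
        rcases Nat.lt_or_ge m j with h | h
        · have := hLR i hi j h hj; omega
        · obtain rfl : j = m := by omega
          have := hmax i (by omega) (by omega); omega
      have h1 := Finset.card_le_card hsub
      have h2 := (Finset.card_image_le (s := Finset.range m) (f := f))
      simp only [Finset.card_range] at h1 h2
      omega
    -- The entries before `m` already use up all values below `m`.
    have hR : ∀ j, m < j → j < n → m ≤ f j := by
      intro j hj hjn
      by_contra hcon
      have hsub : insert (f j) ((Finset.range m).image f) ⊆ Finset.range m := by
        intro v hv
        rcases Finset.mem_insert.1 hv with rfl | hv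
        · exact Finset.mem_range.2 (by omega)
        · obtain ⟨i, hi, rfl⟩ := Finset.mem_image.1 hv
          exact Finset.mem_range.2 (hL i (Finset.mem_range.1 hi))
      have h1 := Finset.card_le_card hsub
      rw [Finset.card_insert_of_notMem, Finset.card_image_of_injOn, Finset.card_range] at h1
      · omega
      · intro a ha b hb h
        simp only [Finset.coe_range, Set.mem_Iio] at ha hb
        exact hinj a (by omega) b (by omega) h
      · intro h
        obtain ⟨i, hi, h⟩ := Finset.mem_image.1 h
        have := hinj i (by have := Finset.mem_range.1 hi; omega) j hjn h
        have := Finset.mem_range.1 hi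
        omega
    obtain ⟨A, hA, hfA⟩ := ih m hm f hL (fun i hi j hj => hinj i (by omega) j (by omega))
      (fun i j p h1 h2 h3 => hav i j p h1 h2 (by omega))
    obtain ⟨B, hB, hfB⟩ := ih (n - 1 - m) (by omega) (fun i => f (m + 1 + i) - m)
      (fun i hi => by
        have := hmax (m + 1 + i) (by omega) (by omega)
        have := hR (m + 1 + i) (by omega) (by omega)
        omega)
      (fun i hi j hj h => by
        have h1 := hR (m + 1 + i) (by omega) (by omega)
        have h2 := hR (m + 1 + j) (by omega) (by omega)
        have := hinj (m + 1 + i) (by omega) (m + 1 + j) (by omega) (by omega)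
        omega)
      (fun i j p h1 h2 h3 => by
        have := hav (m + 1 + i) (m + 1 + j) (m + 1 + p) (by omega) (by omega) (by omega)
        have h1 := hR (m + 1 + i) (by omega) (by omega)
        have h2 := hR (m + 1 + j) (by omega) (by omega)
        have h3 := hR (m + 1 + p) (by omega) (by omega)
        omega)
    refine ⟨node () A B, by simp only [numNodes]; omega, fun i hi => ?_⟩
    rcases position_cases (L := A) (R := B) (i := i) (by omega) with h | h | ⟨j, hj, h⟩
    · rw [treeVal_left h]; exact hfA i (by omega)
    · rw [h, treeVal_root, hA, hfm]; omega
    · have h1 := hfB j (by omega)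
      have h2 := hR (m + 1 + j) (by omega) (by omega)
      rw [h, treeVal_right, hA, ← h1]
      omega

/-! ### Occurrences that cover the root -/

/-- The arrangement of `t` occurs, shifted by some `l`, in that of `T` at the positions `s, s + 1, …`. -/
def TreeOcc (t T : BinaryTree Unit) (s : ℕ) : Prop :=
  s + t.numNodes ≤ T.numNodes ∧ ∃ l, ∀ i < t.numNodes, treeVal T (s + i) = l + treeVal t i

open Classical in
/-- The number of occurrences of the arrangement of `t` in that of `T`. -/
noncomputable def treeCount (t T : BinaryTree Unit) : ℕ :=
  ((Finset.range (T.numNodes + 1)).filter (TreeOcc t T)).card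

/-- There is an occurrence of `t` in `T` that covers the root of `T`. -/
def RootOcc (t : BinaryTree Unit) : BinaryTree Unit → Prop
  | nil => False
  | node u L R => ∃ s ≤ L.numNodes, L.numNodes < s + t.numNodes ∧ TreeOcc t (node u L R) s

/-- The tree obtained from `t` by planting `X` at its leftmost leaf. -/
def leftGraft : BinaryTree Unit → BinaryTree Unit → BinaryTree Unit
  | nil, X => X
  | node u A B, X => node u (leftGraft A X) B

/-- `X` planted below a path of `j` right edges. -/
def rightComb : ℕ → BinaryTree Unit → BinaryTree Unit
  | 0, X => X
  | j + 1, X => node () nil (rightComb j X)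

theorem numNodes_leftGraft (t X : BinaryTree Unit) :
    (leftGraft t X).numNodes = t.numNodes + X.numNodes := by
  induction t with
  | nil => simp [leftGraft]
  | node u A B hA hB => simp only [leftGraft, numNodes, hA]; omega

theorem numNodes_rightComb (j : ℕ) (X : BinaryTree Unit) :
    (rightComb j X).numNodes = j + X.numNodes := by
  induction j with
  | zero => simp [rightComb]
  | succ j ih => simp only [rightComb, numNodes, ih]; omega

theorem leftGraft_injective (t : BinaryTree Unit) : Function.Injective (leftGraft t) := by
  induction t with
  | nil => exact fun _ _ h => h
  | node u A B hA hB =>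
    intro X Y h
    simp only [leftGraft, node.injEq] at h
    exact hA h.2.1

theorem rightComb_injective (j : ℕ) : Function.Injective (rightComb j) := by
  induction j with
  | zero => exact fun _ _ h => h
  | succ j ih =>
    intro X Y h
    simp only [rightComb, node.injEq] at h
    exact ih h.2.2

/-- A tree planted at the leftmost leaf occupies the first positions and the smallest values, so `t`
is only shifted. -/
theorem treeVal_leftGraft (t X : BinaryTree Unit) :
    ∀ i < t.numNodes, treeVal (leftGraft t X) (X.numNodes + i) = X.numNodes + treeVal t i := by
  induction t with
  | nil => intro i h; simp at h
  | node u A B hA hB =>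
    intro i hi
    simp only [numNodes] at hi
    have hn := numNodes_leftGraft A X
    rcases position_cases hi with hi' | rfl | ⟨j, hj, rfl⟩
    · rw [leftGraft, treeVal_left (by omega), treeVal_left hi', hA i hi']
    · rw [leftGraft, show X.numNodes + A.numNodes = (leftGraft A X).numNodes by omega,
        treeVal_root, treeVal_root]
      omega
    · rw [leftGraft, show X.numNodes + (A.numNodes + 1 + j) = (leftGraft A X).numNodes + 1 + j by omega,
        treeVal_right, treeVal_right]
      omega

/-- Each node of the comb has an empty left subtree, so the maximum comes first: the comb is a
decreasing run on the top values, placed before `X`. -/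
theorem treeVal_rightComb (j : ℕ) (X : BinaryTree Unit) :
    ∀ i < j, treeVal (rightComb j X) i = X.numNodes + (j - 1 - i) := by
  induction j with
  | zero => intro i h; omega
  | succ j ih =>
    intro i hi
    have hn := numNodes_rightComb j X
    rcases Nat.eq_zero_or_pos i with rfl | h0
    · have := treeVal_root (u := ()) (L := nil) (R := rightComb j X)
      simp only [numNodes] at this
      rw [rightComb, this]; omega
    · obtain ⟨i, rfl⟩ : ∃ i', i = i' + 1 := ⟨i - 1, by omega⟩
      have := treeVal_right (u := ()) (L := nil) (R := rightComb j X) i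
      simp only [numNodes] at this
      rw [rightComb, show i + 1 = 0 + 1 + i by omega, this, ih i (by omega)]
      omega

/-- If the arrangement of `A` occurs at the end of that of `L`, on the largest values, then `A` is the
top of `L`. -/
theorem exists_leftGraft_of_suffix (A : BinaryTree Unit) :
    ∀ (L : BinaryTree Unit) (d : ℕ), L.numNodes = d + A.numNodes →
      (∀ i < A.numNodes, treeVal L (d + i) = d + treeVal A i) → ∃ X, L = leftGraft A X := by
  induction A with
  | nil => exact fun L d _ _ => ⟨L, rfl⟩
  | node u A B hA hB =>
    intro L d hd hv
    cases L with
    | nil => simp at hd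
    | node u' L R =>
      simp only [numNodes] at hd hv
      have e : d + A.numNodes = L.numNodes := by
        refine eq_root_of_treeVal_eq (u := u') (R := R) (by omega) ?_
        rw [hv _ (by omega), treeVal_root]; omega
      have eR : R = B := by
        refine eq_of_treeVal_eq R B (by omega) fun i hi => ?_
        have := hv (A.numNodes + 1 + i) (by omega)
        rw [show d + (A.numNodes + 1 + i) = L.numNodes + 1 + i by omega, treeVal_right,
          treeVal_right] at this
        omega
      obtain ⟨X, hX⟩ := hA L d (by omega) fun i hi => by
        have := hv i (by omega)
        rwa [treeVal_left (by omega), treeVal_left hi] at this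
      exact ⟨X, by rw [leftGraft, ← hX, eR]⟩

/-- If the arrangement of `B` occurs at the beginning of that of `R`, on the largest values, then `R` is
`B` or extends a right comb `B`. -/
theorem eq_or_rightComb_of_prefix (B : BinaryTree Unit) :
    ∀ (R : BinaryTree Unit) (d : ℕ), R.numNodes = d + B.numNodes →
      (∀ i < B.numNodes, treeVal R i = d + treeVal B i) →
      R = B ∨ ∃ j X, B = rightComb j nil ∧ R = rightComb j X := by
  induction B with
  | nil => exact fun R d _ _ => Or.inr ⟨0, R, rfl, rfl⟩
  | node u A B hA hB =>
    intro R d hd hv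
    cases R with
    | nil => simp at hd
    | node u' L R =>
      simp only [numNodes] at hd hv
      have e : A.numNodes = L.numNodes := by
        refine eq_root_of_treeVal_eq (u := u') (R := R) (by omega) ?_
        rw [hv _ (by omega), treeVal_root]; omega
      rcases Nat.eq_zero_or_pos A.numNodes with h0 | h0
      · have hA0 : A = nil := by cases A with
          | nil => rfl
          | node => simp at h0
        have hL0 : L = nil := by cases L with
          | nil => rfl
          | node => simp at e; omega
        subst hA0 hL0
        simp only [numNodes] at *
        rcases hB R d (by omega) fun i hi => by
          have := hv (0 + 1 + i) (by omega)
          have h1 := treeVal_right (u := u') (L := nil) (R := R) i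
          have h2 := treeVal_right (u := u) (L := nil) (R := B) i
          simp only [numNodes] at h1 h2
          omega with h | ⟨j, X, h1, h2⟩
        · exact Or.inl (by rw [h])
        · exact Or.inr ⟨j + 1, X, by rw [rightComb, h1], by rw [rightComb, h2]⟩
      -- `A` and `L` have the same size, so the maximum of `A`, shifted by `d`, fits below
      -- `L.numNodes` only if `d = 0`.
      · obtain ⟨i, hi, hAi⟩ := exists_treeVal_eq_pred A h0
        have h1 := hv i (by omega)
        rw [treeVal_left (by omega), treeVal_left hi] at h1
        have h2 := treeVal_lt L i (by omega)
        obtain rfl : d = 0 := by omega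
        left
        refine eq_of_treeVal_eq _ _ (by simp only [numNodes]; omega) fun i hi => ?_
        simp only [numNodes] at hi
        rw [hv i (by omega), Nat.zero_add]

/-- The trees with an occurrence of `t` that covers the root. -/
theorem rootOcc_imp {t T : BinaryTree Unit} (ht : 0 < t.numNodes) (h : RootOcc t T) :
    (∃ X, T = leftGraft t X) ∨
      ∃ j L X, t = rightComb (j + 1) nil ∧ T = node () L (rightComb j X) := by
  cases t with
  | nil => simp at ht
  | node u A B =>
  cases T with
  | nil => exact h.elim
  | node u' L R =>
    obtain ⟨s, hs, hs', hle, l, hl⟩ := h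
    simp only [numNodes] at hs' hle hl
    -- The roots align: the occurrence contains the maximum of `T`, which must be its own maximum.
    have e : s + A.numNodes = L.numNodes := by
      refine eq_root_of_treeVal_eq (u := u') (R := R) (by omega) ?_
      have h1 := hl A.numNodes (by omega)
      have h2 := hl (L.numNodes - s) (by omega)
      rw [show s + (L.numNodes - s) = L.numNodes by omega, treeVal_root] at h2
      have h3 := treeVal_lt (node u A B) (L.numNodes - s) (by simp only [numNodes]; omega)
      have h4 := treeVal_lt (node u' L R) (s + A.numNodes) (by simp only [numNodes]; omega)
      rw [treeVal_root] at h1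
      simp only [numNodes] at h3 h4
      omega
    have hl0 := hl A.numNodes (by omega)
    rw [e, treeVal_root, treeVal_root] at hl0
    have hB : ∀ i < B.numNodes, treeVal R i = (R.numNodes - B.numNodes) + treeVal B i := by
      intro i hi
      have := hl (A.numNodes + 1 + i) (by omega)
      rw [show s + (A.numNodes + 1 + i) = L.numNodes + 1 + i by omega, treeVal_right,
        treeVal_right] at this
      omega
    have hLA : B.numNodes = R.numNodes → ∃ X, L = leftGraft A X := fun hBR =>
      exists_leftGraft_of_suffix A L s e.symm fun i hi => by
        have := hl i (by omega)
        rw [treeVal_left (by omega), treeVal_left hi] at this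
        omega
    rcases eq_or_rightComb_of_prefix B R _ (by omega) hB with rfl | ⟨j, X, hBj, hRj⟩
    · obtain ⟨X, hX⟩ := hLA rfl
      exact Or.inl ⟨X, by rw [leftGraft, hX]⟩
    · rcases Nat.eq_zero_or_pos A.numNodes with h0 | h0
      · have hA0 : A = nil := by cases A with
          | nil => rfl
          | node => simp at h0
        exact Or.inr ⟨j, L, X, by rw [rightComb, hBj, hA0], by rw [hRj]⟩
      -- The maximum of a nonempty `A` has value `l + A.numNodes - 1`, which is below `L.numNodes`.
      -- Since the roots align, this forces `B` to fill all of `R`.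
      · obtain ⟨i, hi, hAi⟩ := exists_treeVal_eq_pred A h0
        have h1 := hl i (by omega)
        rw [treeVal_left (by omega), treeVal_left hi] at h1
        have h2 := treeVal_lt L (s + i) (by omega)
        have hBR : B.numNodes = R.numNodes := by omega
        obtain ⟨Y, hY⟩ := hLA hBR
        have hRB : R = B := eq_of_treeVal_eq _ _ hBR.symm fun i hi => by
          have := hB i (by omega)
          omega
        exact Or.inl ⟨Y, by rw [leftGraft, hY, hRB]⟩

theorem rootOcc_leftGraft {t : BinaryTree Unit} (ht : 0 < t.numNodes) (X : BinaryTree Unit) :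
    RootOcc t (leftGraft t X) := by
  cases t with
  | nil => simp at ht
  | node u A B =>
    have h := treeVal_leftGraft (node u A B) X
    have hn := numNodes_leftGraft (node u A B) X
    have hA := numNodes_leftGraft A X
    refine ⟨X.numNodes, by omega, by simp only [numNodes]; omega, by rw [leftGraft] at hn; omega,
      X.numNodes, h⟩

/-- The root followed by the comb is a decreasing run of consecutive values, whatever `L` and `X`
are. This is why the monotone pattern is exceptional. -/
theorem rootOcc_rightComb (j : ℕ) (L X : BinaryTree Unit) :
    RootOcc (rightComb (j + 1) nil) (node () L (rightComb j X)) := by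
  have h1 := numNodes_rightComb (j + 1) nil
  have h2 := numNodes_rightComb j X
  simp only [numNodes] at h1
  refine ⟨L.numNodes, le_rfl, by omega, by simp only [numNodes]; omega,
    L.numNodes + X.numNodes, fun i hi => ?_⟩
  rw [treeVal_rightComb (j + 1) nil i (by omega)]
  simp only [numNodes]
  rcases Nat.eq_zero_or_pos i with rfl | h0
  · rw [Nat.add_zero, treeVal_root]; omega
  · obtain ⟨i, rfl⟩ : ∃ i', i = i' + 1 := ⟨i - 1, by omega⟩
    rw [show L.numNodes + (i + 1) = L.numNodes + 1 + i by omega, treeVal_right,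
      treeVal_rightComb j X i (by omega)]
    omega

/-! ### Additivity of the number of occurrences -/

theorem treeOcc_left_iff {u : Unit} {t L R : BinaryTree Unit} {s : ℕ}
    (hs : s + t.numNodes ≤ L.numNodes) : TreeOcc t (node u L R) s ↔ TreeOcc t L s := by
  unfold TreeOcc
  have h : s + t.numNodes ≤ (node u L R).numNodes := by simp only [numNodes]; omega
  simp only [h, hs, true_and]
  refine exists_congr fun l => forall₂_congr fun i hi => ?_
  rw [treeVal_left (by omega)]

theorem treeOcc_right_iff {u : Unit} {t L R : BinaryTree Unit} {s : ℕ} (ht : 0 < t.numNodes) :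
    TreeOcc t (node u L R) (L.numNodes + 1 + s) ↔ TreeOcc t R s := by
  unfold TreeOcc
  refine and_congr (by simp only [numNodes]; omega) ?_
  constructor
  · rintro ⟨l, hl⟩
    -- At the minimum of `t` the shift `l` is itself a value right of the root, so `L.numNodes ≤ l`
    -- and the truncated subtraction below is exact.
    obtain ⟨i, hi, h0⟩ := exists_treeVal_eq_zero t ht
    have h1 := hl i hi
    rw [Nat.add_assoc, treeVal_right] at h1
    refine ⟨l - L.numNodes, fun i hi => ?_⟩
    have := hl i hi
    rw [Nat.add_assoc, treeVal_right] at this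
    omega
  · rintro ⟨l, hl⟩
    refine ⟨L.numNodes + l, fun i hi => ?_⟩
    rw [Nat.add_assoc, treeVal_right, hl i hi]
    omega

open Classical in
theorem treeCount_nil {t : BinaryTree Unit} (ht : 0 < t.numNodes) : treeCount t nil = 0 := by
  rw [treeCount, Finset.card_eq_zero, Finset.filter_eq_empty_iff]
  intro s _ h
  have := h.1
  simp only [numNodes] at this
  omega

/-- The root of `T` carries the maximum of `t`, whose position in `t` is unique; this fixes the
start of the occurrence. -/
theorem treeOcc_root_unique {u : Unit} {t L R : BinaryTree Unit} {s s' : ℕ}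
    (hs1 : s ≤ L.numNodes) (hs2 : L.numNodes < s + t.numNodes) (hs : TreeOcc t (node u L R) s)
    (hs1' : s' ≤ L.numNodes) (hs2' : L.numNodes < s' + t.numNodes)
    (hs' : TreeOcc t (node u L R) s') : s = s' := by
  have key : ∀ s, s ≤ L.numNodes → L.numNodes < s + t.numNodes → TreeOcc t (node u L R) s →
      treeVal t (L.numNodes - s) + 1 = t.numNodes := by
    intro s h1 h2 ⟨hle, l, hl⟩
    obtain ⟨i, hi, hti⟩ := exists_treeVal_eq_pred t (by omega)
    have h3 := hl i hi
    have h4 := hl (L.numNodes - s) (by omega)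
    rw [show s + (L.numNodes - s) = L.numNodes by omega, treeVal_root] at h4
    have h5 := treeVal_lt (node u L R) (s + i) (by omega)
    have h6 := treeVal_lt t (L.numNodes - s) (by omega)
    simp only [numNodes] at h5
    omega
  have h1 := key s hs1 hs2 hs
  have h2 := key s' hs1' hs2' hs'
  have := treeVal_injOn t (L.numNodes - s) (by omega) (L.numNodes - s') (by omega) (by omega)
  omega

open Classical in
theorem treeCount_node {u : Unit} {t : BinaryTree Unit} (ht : 0 < t.numNodes)
    (L R : BinaryTree Unit) :
    treeCount t (node u L R) =
      treeCount t L + treeCount t R + if RootOcc t (node u L R) then 1 else 0 := by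
  set S := (Finset.range ((node u L R).numNodes + 1)).filter (TreeOcc t (node u L R)) with hS
  have hsplit : S.card = (S.filter fun s => s + t.numNodes ≤ L.numNodes).card +
      ((S.filter fun s => L.numNodes < s).card +
        (S.filter fun s => s ≤ L.numNodes ∧ L.numNodes < s + t.numNodes).card) := by
    rw [← Finset.card_union_of_disjoint, ← Finset.card_union_of_disjoint]
    · congr 1
      ext s
      simp only [Finset.mem_union, Finset.mem_filter]
      constructor
      · intro h
        rcases Nat.lt_or_ge L.numNodes s with h1 | h1
        · exact Or.inr (Or.inl ⟨h, h1⟩)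
        · rcases Nat.lt_or_ge L.numNodes (s + t.numNodes) with h2 | h2
          · exact Or.inr (Or.inr ⟨h, h1, h2⟩)
          · exact Or.inl ⟨h, h2⟩
      · rintro (h | h | h) <;> exact h.1
    · rw [Finset.disjoint_left]
      simp only [Finset.mem_union, Finset.mem_filter]
      rintro s ⟨_, h⟩ (⟨_, h1⟩ | ⟨_, h1⟩) <;> omega
    · rw [Finset.disjoint_left]
      simp only [Finset.mem_filter]
      rintro s ⟨_, h⟩ ⟨_, h1⟩
      omega
  have h1 : (S.filter fun s => s + t.numNodes ≤ L.numNodes).card = treeCount t L := by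
    rw [treeCount]
    congr 1
    ext s
    simp only [hS, Finset.mem_filter, Finset.mem_range, numNodes]
    constructor
    · rintro ⟨⟨_, h⟩, hs⟩
      exact ⟨by omega, (treeOcc_left_iff hs).1 h⟩
    · rintro ⟨_, h⟩
      have := h.1
      exact ⟨⟨by omega, (treeOcc_left_iff this).2 h⟩, this⟩
  have h2 : (S.filter fun s => L.numNodes < s).card = treeCount t R := by
    rw [treeCount]
    symm
    refine Finset.card_bij (fun s _ => L.numNodes + 1 + s) ?_ (fun a _ b _ h => by omega) ?_
    · simp only [hS, Finset.mem_filter, Finset.mem_range, numNodes]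
      rintro s ⟨h, h'⟩
      exact ⟨⟨by omega, (treeOcc_right_iff ht).2 h'⟩, by omega⟩
    · simp only [hS, Finset.mem_filter, Finset.mem_range, numNodes]
      rintro s ⟨⟨h, h'⟩, hs⟩
      refine ⟨s - (L.numNodes + 1), ⟨by omega, (treeOcc_right_iff (u := u) (L := L) ht).1 ?_⟩, by omega⟩
      rwa [show L.numNodes + 1 + (s - (L.numNodes + 1)) = s by omega]
  have h3 : (S.filter fun s => s ≤ L.numNodes ∧ L.numNodes < s + t.numNodes).card =
      if RootOcc t (node u L R) then 1 else 0 := by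
    split_ifs with h
    · obtain ⟨s, hs1, hs2, hs⟩ := h
      rw [Finset.card_eq_one]
      refine ⟨s, ?_⟩
      ext s'
      simp only [hS, Finset.mem_filter, Finset.mem_range, numNodes, Finset.mem_singleton]
      constructor
      · rintro ⟨⟨_, h⟩, h1, h2⟩
        exact treeOcc_root_unique h1 h2 h hs1 hs2 hs
      · rintro rfl
        exact ⟨⟨by omega, hs⟩, hs1, hs2⟩
    · rw [Finset.card_eq_zero, Finset.filter_eq_empty_iff]
      intro s hs h'
      exact h ⟨s, h'.1, h'.2, (Finset.mem_filter.1 hs).2⟩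
  rw [treeCount, hsplit, h1, h2, h3, Nat.add_assoc]

/-! ### Enumeration of root occurrences and the recursion for totals -/

open Finset in
theorem sum_trees_succ {M : Type*} [AddCommMonoid M] (n : ℕ) (F : BinaryTree Unit → M) :
    ∑ T ∈ treesOfNumNodesEq (n + 1), F T =
      ∑ ij ∈ antidiagonal n, ∑ L ∈ treesOfNumNodesEq ij.1, ∑ R ∈ treesOfNumNodesEq ij.2,
        F (node () L R) := by
  rw [treesOfNumNodesEq_succ, sum_biUnion]
  · refine sum_congr rfl fun ij _ => ?_
    rw [sum_map, sum_product]
    rfl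
  · simp_rw [Set.PairwiseDisjoint, Set.Pairwise, disjoint_left]
    aesop

-- Outside the comb case only the first alternative of `rootOcc_imp` is possible, so the planted
-- tree `X` is a free parameter.
open Classical in
theorem card_rootOcc_of_ne {t : BinaryTree Unit} (ht : 0 < t.numNodes)
    (hne : t ≠ rightComb t.numNodes nil) (m : ℕ) :
    ((treesOfNumNodesEq (t.numNodes + m)).filter (RootOcc t)).card = catalan m := by
  rw [← treesOfNumNodesEq_card_eq_catalan m,
    ← Finset.card_image_of_injective (treesOfNumNodesEq m) (leftGraft_injective t)]
  congr 1
  ext T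
  simp only [Finset.mem_filter, mem_treesOfNumNodesEq, Finset.mem_image]
  constructor
  · rintro ⟨hT, h⟩
    rcases rootOcc_imp ht h with ⟨X, rfl⟩ | ⟨j, L, X, h1, -⟩
    · exact ⟨X, by have := numNodes_leftGraft t X; omega, rfl⟩
    · have := numNodes_rightComb (j + 1) nil
      rw [← h1, numNodes, Nat.add_zero] at this
      exact absurd (this ▸ h1) hne
  · rintro ⟨X, hX, rfl⟩
    exact ⟨by rw [numNodes_leftGraft, hX], rootOcc_leftGraft ht X⟩

/-- Insertion of a path of `j` right edges below the root. -/
def stretchRoot (j : ℕ) : BinaryTree Unit → BinaryTree Unit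
  | nil => nil
  | node u L R => node u L (rightComb j R)

theorem stretchRoot_injective (j : ℕ) : Function.Injective (stretchRoot j) := by
  rintro (_ | ⟨u, L, R⟩) (_ | ⟨u', L', R'⟩) h
  · rfl
  · simp [stretchRoot] at h
  · simp [stretchRoot] at h
  · simp only [stretchRoot, node.injEq] at h
    rw [h.2.1, rightComb_injective j h.2.2]

-- Both alternatives of `rootOcc_imp` have the form `node () L (rightComb k X)`, the first with `X =
-- nil`. Contracting the comb leaves an arbitrary tree with `m + 1` nodes.
open Classical in
theorem card_rootOcc_rightComb (k m : ℕ) :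
    ((treesOfNumNodesEq (k + 1 + m)).filter (RootOcc (rightComb (k + 1) nil))).card =
      catalan (m + 1) := by
  rw [← treesOfNumNodesEq_card_eq_catalan (m + 1),
    ← Finset.card_image_of_injective (treesOfNumNodesEq (m + 1)) (stretchRoot_injective k)]
  congr 1
  ext T
  simp only [Finset.mem_filter, mem_treesOfNumNodesEq, Finset.mem_image]
  have hk := numNodes_rightComb (k + 1) nil
  simp only [numNodes] at hk
  constructor
  · rintro ⟨hT, h⟩
    have : ∃ L X, T = node () L (rightComb k X) := by
      rcases rootOcc_imp (by omega) h with ⟨X, rfl⟩ | ⟨j, L, X, h1, h2⟩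
      · exact ⟨X, nil, rfl⟩
      · have := numNodes_rightComb (j + 1) nil
        rw [← h1, hk] at this
        simp only [numNodes] at this
        obtain rfl : j = k := by omega
        exact ⟨L, X, h2⟩
    obtain ⟨L, X, rfl⟩ := this
    simp only [numNodes, numNodes_rightComb] at hT
    exact ⟨node () L X, by simp only [numNodes]; omega, rfl⟩
  · rintro ⟨X, hX, rfl⟩
    cases X with
    | nil => simp at hX
    | node u L R =>
      simp only [numNodes] at hX
      refine ⟨by simp only [stretchRoot, numNodes, numNodes_rightComb]; omega, ?_⟩
      exact rootOcc_rightComb k L R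

theorem treeCount_eq_zero_of_lt {t : BinaryTree Unit} (T : BinaryTree Unit)
    (h : T.numNodes < t.numNodes) : treeCount t T = 0 := by
  classical
  rw [treeCount, Finset.card_eq_zero]
  refine Finset.filter_false_of_mem fun s _ h' => ?_
  have := h'.1
  omega

/-- The total number of occurrences of `t` in the trees with `n` nodes. -/
noncomputable def totalCount (t : BinaryTree Unit) (n : ℕ) : ℝ :=
  ∑ T ∈ treesOfNumNodesEq n, (treeCount t T : ℝ)

open Finset in
/-- The total of an additive functional. -/
theorem sum_additive_succ {F g : BinaryTree Unit → ℝ}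
    (hF : ∀ L R, F (node () L R) = F L + F R + g (node () L R)) (n : ℕ) :
    ∑ T ∈ treesOfNumNodesEq (n + 1), F T =
      2 * ∑ ij ∈ antidiagonal n, (∑ T ∈ treesOfNumNodesEq ij.1, F T) * (catalan ij.2 : ℝ) +
        ∑ T ∈ treesOfNumNodesEq (n + 1), g T := by
  have hsw : ∑ ij ∈ antidiagonal n, (catalan ij.1 : ℝ) * (∑ T ∈ treesOfNumNodesEq ij.2, F T) =
      ∑ ij ∈ antidiagonal n, (∑ T ∈ treesOfNumNodesEq ij.1, F T) * (catalan ij.2 : ℝ) := by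
    rw [← Finset.Nat.sum_antidiagonal_swap]
    exact sum_congr rfl fun ij _ => mul_comm _ _
  rw [two_mul]
  nth_rewrite 1 [← hsw]
  rw [sum_trees_succ, sum_trees_succ, ← sum_add_distrib, ← sum_add_distrib]
  refine sum_congr rfl fun ij _ => ?_
  simp only [hF, sum_add_distrib, sum_const, treesOfNumNodesEq_card_eq_catalan, nsmul_eq_mul]
  rw [← mul_sum]
  ring

open Classical Finset in
theorem totalCount_succ {t : BinaryTree Unit} (ht : 0 < t.numNodes) (n : ℕ) :
    totalCount t (n + 1) =
      2 * ∑ ij ∈ antidiagonal n, totalCount t ij.1 * (catalan ij.2 : ℝ) +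
        (((treesOfNumNodesEq (n + 1)).filter (RootOcc t)).card : ℝ) := by
  rw [totalCount, sum_additive_succ (g := fun T => if RootOcc t T then 1 else 0)]
  · simp [totalCount]
  · intro L R
    rw [treeCount_node ht]
    push_cast
    rfl

theorem totalCount_of_lt {t : BinaryTree Unit} {n : ℕ} (h : n < t.numNodes) :
    totalCount t n = 0 := by
  refine Finset.sum_eq_zero fun T hT => ?_
  rw [mem_treesOfNumNodesEq] at hT
  rw [treeCount_eq_zero_of_lt T (by omega), Nat.cast_zero]

open Finset in
theorem sum_antidiagonal_shift {f g : ℕ → ℝ} {k : ℕ} (hf : ∀ i < k, f i = 0) (n : ℕ) :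
    ∑ ij ∈ antidiagonal (k + n), f ij.1 * g ij.2 =
      ∑ ij ∈ antidiagonal n, f (k + ij.1) * g ij.2 := by
  rw [Nat.sum_antidiagonal_eq_sum_range_succ_mk, Nat.sum_antidiagonal_eq_sum_range_succ_mk,
    show (k + n).succ = k + n.succ by omega, sum_range_add, sum_eq_zero, zero_add]
  · refine sum_congr rfl fun i _ => ?_
    simp only
    rw [show k + n - (k + i) = n - i by omega]
  · intro i hi
    simp only [hf i (mem_range.1 hi), zero_mul]

/-- The shift of an additive recursion whose first terms vanish. -/
theorem totalCount_shift_succ {t : BinaryTree Unit} (ht : 0 < t.numNodes) {c : ℕ → ℕ}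
    (hc : ∀ m, (open Classical in ((treesOfNumNodesEq (t.numNodes + m)).filter (RootOcc t)).card) = c m) :
    totalCount t t.numNodes = c 0 ∧ ∀ m, totalCount t (t.numNodes + (m + 1)) =
      2 * ∑ ij ∈ Finset.HasAntidiagonal.antidiagonal m, totalCount t (t.numNodes + ij.1) * (catalan ij.2 : ℝ) +
        c (m + 1) := by
  constructor
  · obtain ⟨n, hn⟩ : ∃ n, t.numNodes = n + 1 := ⟨t.numNodes - 1, by omega⟩
    have h := hc 0
    rw [Nat.add_zero, hn] at h
    rw [hn, totalCount_succ ht, h, Finset.sum_eq_zero, mul_zero, zero_add]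
    intro ij hij
    have := Finset.HasAntidiagonal.mem_antidiagonal.1 hij
    rw [totalCount_of_lt (by omega), zero_mul]
  · intro m
    rw [← Nat.add_assoc, totalCount_succ ht, Nat.add_assoc, hc,
      sum_antidiagonal_shift (f := totalCount t) (g := fun j => (catalan j : ℝ))
        fun i hi => totalCount_of_lt hi]

/-! ### Catalan convolutions and the exact totals -/

theorem centralBinom_eq (n : ℕ) : (Nat.centralBinom n : ℝ) = (n + 1) * catalan n := by
  exact_mod_cast (succ_mul_catalan_eq_centralBinom n).symm

theorem centralBinom_succ_eq (n : ℕ) :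
    (Nat.centralBinom (n + 1) : ℝ) = 2 * (2 * n + 1) * catalan n := by
  have h1 : ((n : ℝ) + 1) * Nat.centralBinom (n + 1) = 2 * (2 * n + 1) * Nat.centralBinom n := by
    exact_mod_cast Nat.succ_mul_centralBinom_succ n
  rw [centralBinom_eq n] at h1
  have h2 : (n : ℝ) + 1 ≠ 0 := by positivity
  apply mul_left_cancel₀ h2
  rw [h1]; ring

open Finset in
theorem sum_catalan_mul (n : ℕ) :
    ∑ ij ∈ antidiagonal n, (catalan ij.1 : ℝ) * catalan ij.2 = catalan (n + 1) := by
  rw [catalan_succ']; push_cast; rfl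

-- Symmetrisation: the weights `i + 1` and `j + 1` add up to the constant `n + 2`, which leaves the
-- Catalan convolution.
open Finset in
theorem two_mul_sum_centralBinom_mul_catalan (n : ℕ) :
    2 * ∑ ij ∈ antidiagonal n, (Nat.centralBinom ij.1 : ℝ) * catalan ij.2 =
      Nat.centralBinom (n + 1) := by
  have hsw : ∑ ij ∈ antidiagonal n, (Nat.centralBinom ij.1 : ℝ) * catalan ij.2 =
      ∑ ij ∈ antidiagonal n, (catalan ij.1 : ℝ) * Nat.centralBinom ij.2 := by
    rw [← Finset.Nat.sum_antidiagonal_swap]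
    exact sum_congr rfl fun ij _ => mul_comm _ _
  rw [two_mul]
  nth_rewrite 2 [hsw]
  rw [← sum_add_distrib, centralBinom_eq (n + 1), ← sum_catalan_mul, mul_sum]
  refine sum_congr rfl fun ij hij => ?_
  have : (ij.1 : ℝ) + ij.2 = n := by exact_mod_cast mem_antidiagonal.1 hij
  rw [centralBinom_eq, centralBinom_eq, Nat.cast_add n 1, ← this]
  push_cast
  ring

open Finset in
theorem sum_antidiagonal_succ_left {f g : ℕ → ℝ} (n : ℕ) :
    ∑ ij ∈ antidiagonal n, f (ij.1 + 1) * g ij.2 =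
      ∑ ij ∈ antidiagonal (n + 1), f ij.1 * g ij.2 - f 0 * g (n + 1) := by
  rw [Nat.sum_antidiagonal_succ]
  ring

/-- Shifting the index in the convolution loses its term at `0`, which is `catalan (m + 1)`; the
toll restores exactly this term. -/
theorem totalCount_of_ne {t : BinaryTree Unit} (ht : 0 < t.numNodes)
    (hne : t ≠ rightComb t.numNodes nil) (m : ℕ) :
    totalCount t (t.numNodes + m) = (Nat.centralBinom (m + 1) : ℝ) / 2 := by
  obtain ⟨h0, hs⟩ := totalCount_shift_succ ht (card_rootOcc_of_ne ht hne)
  induction m using Nat.strong_induction_on with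
  | _ m ih =>
    cases m with
    | zero => rw [Nat.add_zero, h0]; simp [Nat.centralBinom]
    | succ m =>
      rw [hs, Finset.sum_congr rfl (g := fun ij => (1 / 2 : ℝ) *
        ((Nat.centralBinom (ij.1 + 1) : ℝ) * catalan ij.2))]
      · rw [← Finset.mul_sum, sum_antidiagonal_succ_left (f := fun i => (Nat.centralBinom i : ℝ))
          (g := fun i => (catalan i : ℝ))]
        have := two_mul_sum_centralBinom_mul_catalan (m + 1)
        simp only [Nat.centralBinom_zero]
        push_cast
        linarith
      · intro ij hij
        have := Finset.HasAntidiagonal.mem_antidiagonal.1 hij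
        rw [ih _ (by omega)]; ring

/-- The boundary terms of the two shifted convolutions cancel. The toll `catalan (m + 2)` then
offsets half of the `2 * catalan (m + 2)` subtracted. -/
theorem totalCount_rightComb (k m : ℕ) :
    totalCount (rightComb (k + 1) nil) (k + 1 + m) =
      (Nat.centralBinom (m + 1) : ℝ) - catalan (m + 1) := by
  have hk : (rightComb (k + 1) nil).numNodes = k + 1 := by simp [numNodes_rightComb]
  obtain ⟨h0, hs⟩ := totalCount_shift_succ (t := rightComb (k + 1) nil) (by omega)
    (c := fun m => catalan (m + 1)) (by rw [hk]; exact card_rootOcc_rightComb k)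
  rw [hk] at h0 hs
  induction m using Nat.strong_induction_on with
  | _ m ih =>
    cases m with
    | zero => rw [Nat.add_zero, h0]; simp [Nat.centralBinom]; norm_num
    | succ m =>
      rw [hs, Finset.sum_congr rfl (g := fun ij =>
        (Nat.centralBinom (ij.1 + 1) : ℝ) * catalan ij.2 - (catalan (ij.1 + 1) : ℝ) * catalan ij.2)]
      · rw [Finset.sum_sub_distrib,
          sum_antidiagonal_succ_left (f := fun i => (Nat.centralBinom i : ℝ))
            (g := fun i => (catalan i : ℝ)),
          sum_antidiagonal_succ_left (f := fun i => (catalan i : ℝ))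
            (g := fun i => (catalan i : ℝ)), sum_catalan_mul]
        have := two_mul_sum_centralBinom_mul_catalan (m + 1)
        simp only [Nat.centralBinom_zero, catalan_zero]
        push_cast
        linarith
      · intro ij hij
        have := Finset.HasAntidiagonal.mem_antidiagonal.1 hij
        rw [ih _ (by omega)]; ring

/-! ### The mean up to a bounded error -/

theorem catalan_le_succ (n : ℕ) : (catalan n : ℝ) ≤ catalan (n + 1) := by
  have h := centralBinom_eq (n + 1)
  rw [centralBinom_succ_eq] at h
  push_cast at h
  have h0 : (0 : ℝ) ≤ catalan n := by positivity
  have h1 : (0 : ℝ) ≤ n := by positivity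
  have h2 : ((n : ℝ) + 2) * catalan n ≤ (n + 2) * catalan (n + 1) := by nlinarith
  exact le_of_mul_le_mul_left h2 (by positivity)

theorem catalan_monotone : Monotone fun n => (catalan n : ℝ) :=
  monotone_nat_of_le_succ catalan_le_succ

theorem catalan_cast_pos (n : ℕ) : (0 : ℝ) < catalan n := by
  have h := centralBinom_eq n
  have h1 : (0 : ℝ) < Nat.centralBinom n := by exact_mod_cast Nat.centralBinom_pos n
  rw [h] at h1
  exact pos_of_mul_pos_right h1 (by positivity)

/-- One step costs `4 * centralBinom n - centralBinom (n + 1) = 2 * catalan n`, a factor of order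
`n` below the main term; iterate `j` times. -/
theorem exists_abs_centralBinom_shift_le (j : ℕ) : ∃ K : ℝ, 0 ≤ K ∧ ∀ n : ℕ,
    |(Nat.centralBinom n : ℝ) * 4 ^ j - Nat.centralBinom (n + j)| ≤ K * catalan (n + j) := by
  induction j with
  | zero => exact ⟨0, le_rfl, fun n => by simp⟩
  | succ j ih =>
    obtain ⟨K, hK, h⟩ := ih
    refine ⟨K + 2 * 4 ^ j, by positivity, fun n => ?_⟩
    have h1 := h (n + 1)
    rw [show n + 1 + j = n + (j + 1) by omega] at h1
    have h2 : (Nat.centralBinom n : ℝ) * 4 ^ (j + 1) - Nat.centralBinom (n + 1) * 4 ^ j =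
        2 * 4 ^ j * catalan n := by
      rw [centralBinom_eq, centralBinom_succ_eq]; ring
    have h3 : (catalan n : ℝ) ≤ catalan (n + (j + 1)) := catalan_monotone (by omega)
    calc |(Nat.centralBinom n : ℝ) * 4 ^ (j + 1) - Nat.centralBinom (n + (j + 1))|
        = |((Nat.centralBinom (n + 1) : ℝ) * 4 ^ j - Nat.centralBinom (n + (j + 1))) +
            2 * 4 ^ j * catalan n| := by rw [← h2]; congr 1; ring
      _ ≤ K * catalan (n + (j + 1)) + 2 * 4 ^ j * catalan n := by
          refine (abs_add_le _ _).trans (add_le_add h1 (le_of_eq (abs_of_nonneg (by positivity))))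
      _ ≤ _ := by rw [add_mul]; gcongr

/-- The total number of occurrences of `t`, up to the order of the number of trees. -/
theorem exists_abs_totalCount_sub_le {t : BinaryTree Unit} (ht : 0 < t.numNodes) :
    ∃ c K : ℝ, 0 < c ∧ 0 ≤ K ∧ ∀ n : ℕ,
      |totalCount t n - c * n * catalan n| ≤ K * catalan n := by
  obtain ⟨k, hk⟩ : ∃ k, t.numNodes = k + 1 := ⟨t.numNodes - 1, by omega⟩
  obtain ⟨a, b, ha, hb, hab⟩ : ∃ a b : ℝ, 0 < a ∧ 0 ≤ b ∧ ∀ m,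
      totalCount t (k + 1 + m) = a * Nat.centralBinom (m + 1) - b * catalan (m + 1) := by
    by_cases hne : t = rightComb t.numNodes nil
    · rw [hk] at hne
      exact ⟨1, 1, one_pos, zero_le_one, fun m => by rw [hne, totalCount_rightComb]; ring⟩
    · exact ⟨1 / 2, 0, by norm_num, le_rfl, fun m => by
        rw [← hk, totalCount_of_ne ht hne]; ring⟩
  obtain ⟨K, hK, hs⟩ := exists_abs_centralBinom_shift_le k
  set c : ℝ := a / 4 ^ k with hc
  have hc0 : 0 < c := by positivity
  -- The summands pay, in order, for the shift by `k`, the Catalan correction for combs, replacing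
  -- `n + 1` by `n`, and the sizes `n < k + 1` with no occurrence.
  refine ⟨c, c * K + b + c + c * (k + 1), hc0, by positivity, fun n => ?_⟩
  have hC := catalan_cast_pos n
  rcases Nat.lt_or_ge n (k + 1) with hn | hn
  · rw [totalCount_of_lt (by omega), zero_sub, abs_neg, abs_of_nonneg (by positivity)]
    have : (n : ℝ) ≤ k + 1 := by exact_mod_cast hn.le
    have h1 : c * n ≤ c * (k + 1) := by gcongr
    have h2 : 0 ≤ c * K + b + c := by positivity
    gcongr
    linarith
  · obtain ⟨m, rfl⟩ := Nat.exists_eq_add_of_le hn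
    have h1 := hs (m + 1)
    rw [show m + 1 + k = k + 1 + m by omega, centralBinom_eq (k + 1 + m)] at h1
    have h2 : (catalan (m + 1) : ℝ) ≤ catalan (k + 1 + m) := catalan_monotone (by omega)
    have e : totalCount t (k + 1 + m) - c * (k + 1 + m : ℕ) * catalan (k + 1 + m) =
        c * ((Nat.centralBinom (m + 1) : ℝ) * 4 ^ k -
          (((k + 1 + m : ℕ) : ℝ) + 1) * catalan (k + 1 + m)) +
        (c * catalan (k + 1 + m) - b * catalan (m + 1)) := by
      rw [hab, hc]; field_simp; ring
    rw [e]
    have h3 : |c * ((Nat.centralBinom (m + 1) : ℝ) * 4 ^ k -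
          (((k + 1 + m : ℕ) : ℝ) + 1) * catalan (k + 1 + m))| ≤ c * (K * catalan (k + 1 + m)) := by
      rw [abs_mul, abs_of_pos hc0]; gcongr
    have h4 : |c * (catalan (k + 1 + m) : ℝ) - b * catalan (m + 1)| ≤
        c * catalan (k + 1 + m) + b * catalan (k + 1 + m) := by
      refine (abs_sub _ _).trans ?_
      rw [abs_of_nonneg (by positivity), abs_of_nonneg (by positivity)]
      gcongr
    have h5 : 0 ≤ c * (k + 1) * catalan (k + 1 + m) := by positivity
    refine (abs_add_le _ _).trans ((add_le_add h3 h4).trans ?_)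
    nlinarith

/-! ### Second moment and concentration -/

-- The powers `4 ^ n` solve the additive recursion exactly with total toll `centralBinom`, so they
-- dominate any solution with comparable toll.
open Finset in
theorem two_mul_sum_four_pow_mul_catalan (n : ℕ) :
    2 * ∑ ij ∈ antidiagonal n, (4 : ℝ) ^ ij.1 * catalan ij.2 + Nat.centralBinom (n + 1) =
      4 ^ (n + 1) := by
  induction n with
  | zero => simp [Nat.centralBinom]; norm_num
  | succ n ih =>
    rw [Nat.sum_antidiagonal_succ, centralBinom_succ_eq (n + 1)]
    have : ∑ ij ∈ antidiagonal n, (4 : ℝ) ^ (ij.1 + 1) * catalan ij.2 =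
        4 * ∑ ij ∈ antidiagonal n, (4 : ℝ) ^ ij.1 * catalan ij.2 := by
      rw [mul_sum]; exact sum_congr rfl fun ij _ => by ring
    simp only [this]
    rw [pow_succ, ← ih, centralBinom_eq (n + 1)]
    push_cast
    ring

theorem abs_le_of_additive {G g : BinaryTree Unit → ℝ} {K : ℝ} (h0 : G nil = 0)
    (hG : ∀ L R, G (node () L R) = G L + G R + g (node () L R)) (hg : ∀ T, |g T| ≤ K)
    (T : BinaryTree Unit) : |G T| ≤ K * T.numNodes := by
  induction T with
  | nil => simp [h0]
  | node u L R hL hR =>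
    rw [hG]
    simp only [numNodes]
    push_cast
    have := hg (node () L R)
    have h1 := abs_add_le (G L + G R) (g (node () L R))
    have h2 := abs_add_le (G L) (G R)
    linarith

/-- The part of the square of an additive functional that is not additive. -/
def squareToll (G g : BinaryTree Unit → ℝ) : BinaryTree Unit → ℝ
  | nil => 0
  | node u L R => 2 * G L * G R + 2 * g (node u L R) * (G L + G R) + g (node u L R) ^ 2

open Finset in
/-- The second moment of a centred additive functional with bounded toll. -/
theorem exists_sum_sq_le {G g : BinaryTree Unit → ℝ} {K M : ℝ} (h0 : G nil = 0)
    (hG : ∀ L R, G (node () L R) = G L + G R + g (node () L R)) (hg : ∀ T, |g T| ≤ K)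
    (hM : ∀ n, |∑ T ∈ treesOfNumNodesEq n, G T| ≤ M * catalan n) :
    ∃ B : ℝ, 0 ≤ B ∧ ∀ n, ∑ T ∈ treesOfNumNodesEq n, G T ^ 2 ≤ B * 4 ^ n := by
  have hK : 0 ≤ K := (abs_nonneg _).trans (hg nil)
  have hM0 : 0 ≤ M := by
    have := (abs_nonneg _).trans (hM 0)
    simpa using this
  set B := 2 * M ^ 2 + 2 * K ^ 2 with hB
  have hB0 : 0 ≤ B := by positivity
  refine ⟨B, hB0, fun n => ?_⟩
  -- The sum of `G L * G R` factors into two totals, each bounded through `hM`; this is where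
  -- centring enters. The remaining terms use only `|G T| ≤ K * T.numNodes`. Together they are at
  -- most `B * (n + 2)` times the number of pairs.
  have htoll : ∀ n, ∑ T ∈ treesOfNumNodesEq (n + 1), squareToll G g T ≤
      B * Nat.centralBinom (n + 1) := by
    intro n
    have hpt : ∀ ij ∈ antidiagonal n, ∑ L ∈ treesOfNumNodesEq ij.1,
        ∑ R ∈ treesOfNumNodesEq ij.2, squareToll G g (node () L R) ≤
        B * (n + 2) * (catalan ij.1 * catalan ij.2) := by
      intro ij hij
      have hn : (ij.1 : ℝ) + ij.2 = n := by exact_mod_cast mem_antidiagonal.1 hij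
      have h1 : ∀ L ∈ treesOfNumNodesEq ij.1, ∀ R ∈ treesOfNumNodesEq ij.2,
          squareToll G g (node () L R) ≤ 2 * (G L * G R) + (2 * K ^ 2 * n + K ^ 2) := by
        intro L hL R hR
        rw [mem_treesOfNumNodesEq] at hL hR
        have h2 := abs_le_of_additive h0 hG hg L
        have h3 := abs_le_of_additive h0 hG hg R
        rw [hL] at h2
        rw [hR] at h3
        have h4 := abs_add_le (G L) (G R)
        have h5 : |g (node () L R) * (G L + G R)| ≤ K * (K * n) := by
          rw [abs_mul]
          refine mul_le_mul (hg _) ?_ (abs_nonneg _) hK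
          rw [← hn, mul_add]
          linarith
        have h6 : g (node () L R) ^ 2 ≤ K ^ 2 := by
          rw [← sq_abs]; exact pow_le_pow_left₀ (abs_nonneg _) (hg _) 2
        have h7 := le_abs_self (g (node () L R) * (G L + G R))
        simp only [squareToll]
        nlinarith
      calc _ ≤ ∑ L ∈ treesOfNumNodesEq ij.1, ∑ R ∈ treesOfNumNodesEq ij.2,
            (2 * (G L * G R) + (2 * K ^ 2 * n + K ^ 2)) :=
          sum_le_sum fun L hL => sum_le_sum fun R hR => h1 L hL R hR
        _ = 2 * ((∑ L ∈ treesOfNumNodesEq ij.1, G L) * ∑ R ∈ treesOfNumNodesEq ij.2, G R) +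
            (2 * K ^ 2 * n + K ^ 2) * (catalan ij.1 * catalan ij.2) := by
          rw [sum_mul_sum]
          simp only [sum_add_distrib, sum_const, treesOfNumNodesEq_card_eq_catalan, nsmul_eq_mul,
            mul_sum]
          ring
        _ ≤ 2 * ((M * catalan ij.1) * (M * catalan ij.2)) +
            (2 * K ^ 2 * n + K ^ 2) * (catalan ij.1 * catalan ij.2) := by
          refine add_le_add_left (mul_le_mul_of_nonneg_left ?_ zero_le_two) _
          refine (le_abs_self _).trans ?_
          rw [abs_mul]
          exact mul_le_mul (hM _) (hM _) (abs_nonneg _) (by positivity)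
        _ = (2 * M ^ 2 + (2 * K ^ 2 * n + K ^ 2)) * (catalan ij.1 * catalan ij.2) := by ring
        _ ≤ _ := by
          gcongr
          rw [hB]
          have : (0 : ℝ) ≤ n := by positivity
          nlinarith [sq_nonneg K, sq_nonneg M, mul_nonneg this (sq_nonneg M)]
    rw [sum_trees_succ]
    refine (sum_le_sum hpt).trans (le_of_eq ?_)
    rw [← mul_sum, sum_catalan_mul, centralBinom_eq]
    push_cast
    ring
  induction n using Nat.strong_induction_on with
  | _ n ih =>
    cases n with
    | zero => simp [h0, hB0]
    | succ n =>
      rw [sum_additive_succ (g := squareToll G g)]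
      · rw [← two_mul_sum_four_pow_mul_catalan, mul_add B]
        refine add_le_add ?_ (htoll n)
        rw [mul_left_comm B]
        refine mul_le_mul_of_nonneg_left ?_ zero_le_two
        rw [mul_sum]
        refine sum_le_sum fun ij hij => ?_
        have := mem_antidiagonal.1 hij
        rw [← mul_assoc]
        exact mul_le_mul_of_nonneg_right (ih _ (by omega)) (by positivity)
      · intro L R
        rw [hG]
        simp only [squareToll]
        ring

/-- The square of `4 ^ n ≤ 2 * √n * centralBinom n`, stated without roots so that induction applies.
-/
theorem sixteen_pow_le (n : ℕ) :
    (16 : ℝ) ^ (n + 1) ≤ 4 * (n + 1) * (Nat.centralBinom (n + 1) : ℝ) ^ 2 := by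
  induction n with
  | zero => simp [Nat.centralBinom]; norm_num
  | succ n ih =>
    have h := centralBinom_succ_eq (n + 1)
    have h1 := centralBinom_eq (n + 1)
    push_cast at h h1 ⊢
    rw [h]
    rw [h1] at ih
    have h2 : (0 : ℝ) ≤ n := by positivity
    have h3 : (0 : ℝ) ≤ (catalan (n + 1) : ℝ) ^ 2 := by positivity
    -- After cancellation this is `4 * (n + 1) * (n + 2) ≤ (2 * n + 3) ^ 2`, whose sides differ by
    -- `1`.
    have h4 : 16 * (4 * ((n : ℝ) + 1) * (n + 1 + 1) ^ 2) ≤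
        4 * (n + 1 + 1) * (2 * (2 * (n + 1) + 1)) ^ 2 := by nlinarith
    calc (16 : ℝ) ^ (n + 1 + 1) = 16 * 16 ^ (n + 1) := by ring
      _ ≤ 16 * (4 * (n + 1) * ((n + 1 + 1) * catalan (n + 1)) ^ 2) := by gcongr
      _ = 16 * (4 * ((n : ℝ) + 1) * (n + 1 + 1) ^ 2) * (catalan (n + 1) : ℝ) ^ 2 := by ring
      _ ≤ 4 * (n + 1 + 1) * (2 * (2 * (n + 1) + 1)) ^ 2 * (catalan (n + 1) : ℝ) ^ 2 := by gcongr
      _ = _ := by ring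

theorem four_pow_le_sqrt_mul_catalan {n : ℕ} (hn : 0 < n) :
    (4 : ℝ) ^ n ≤ 2 * √n * ((n + 1) * catalan n) := by
  obtain ⟨m, rfl⟩ : ∃ m, n = m + 1 := ⟨n - 1, by omega⟩
  have h := sixteen_pow_le m
  refine le_of_sq_le_sq ?_ (by positivity)
  rw [← centralBinom_eq, mul_pow, mul_pow, Real.sq_sqrt (by positivity), ← pow_mul,
    mul_comm (m + 1) 2, pow_mul]
  push_cast
  norm_num at h ⊢
  linarith

/-- The number of occurrences of `t` in a random tree is concentrated. -/
theorem tendsto_treeCount_ratio {t : BinaryTree Unit} (ht : 0 < t.numNodes) {ε : ℝ} (hε : 0 < ε) :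
    Tendsto (fun n : ℕ => (((treesOfNumNodesEq n).filter fun T =>
      ε ≤ |(treeCount t T : ℝ) / (totalCount t n / catalan n) - 1|).card : ℝ) / catalan n)
      atTop (𝓝 0) := by
  classical
  obtain ⟨c, K, hc, hK, hmean⟩ := exists_abs_totalCount_sub_le ht
  obtain ⟨B, hB, hsq⟩ := exists_sum_sq_le (G := fun T => (treeCount t T : ℝ) - c * T.numNodes)
    (g := fun T => (if RootOcc t T then 1 else 0) - c) (K := 1 + c) (M := K)
    (by simp [treeCount_nil ht])
    (fun L R => by
      simp only [treeCount_node ht, numNodes]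
      push_cast
      ring)
    (fun T => by
      split_ifs
      · exact (abs_sub _ _).trans (by rw [abs_one, abs_of_pos hc])
      · exact (abs_sub _ _).trans (by rw [abs_zero, abs_of_pos hc]; linarith))
    (fun n => by
      have : ∑ T ∈ treesOfNumNodesEq n, ((treeCount t T : ℝ) - c * T.numNodes) =
          totalCount t n - c * n * catalan n := by
        rw [Finset.sum_sub_distrib, totalCount, Finset.sum_congr rfl (fun T hT => by
          rw [mem_treesOfNumNodesEq.1 hT] : ∀ T ∈ treesOfNumNodesEq n, c * (T.numNodes : ℝ) = c * n),
          Finset.sum_const, treesOfNumNodesEq_card_eq_catalan, nsmul_eq_mul]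
        ring
      rw [this]
      exact hmean n)
  -- Half of the deviation `ε * c * n`; for large `n` the other half absorbs the error `K` of the
  -- mean.
  set δ := ε * c / 2 with hδ
  have hδ0 : 0 < δ := by positivity
  have hlim : Tendsto (fun n : ℕ => (4 * B / δ ^ 2) / √(n : ℝ)) atTop (𝓝 0) :=
    (Real.tendsto_sqrt_atTop.comp tendsto_natCast_atTop_atTop).const_div_atTop _
  refine squeeze_zero' (Eventually.of_forall fun n => by positivity) ?_ hlim
  -- The first summand ensures `ε * K + K ≤ δ * n`, the second that the mean is positive.
  obtain ⟨N, hN⟩ := exists_nat_gt ((ε * K + K) / δ + K / c)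
  filter_upwards [eventually_ge_atTop (max N 1)] with n hn
  have hn1 : 1 ≤ n := (le_max_right _ _).trans hn
  have hnR : (1 : ℝ) ≤ n := by exact_mod_cast hn1
  have hnN : (N : ℝ) ≤ n := by exact_mod_cast (le_max_left _ _).trans hn
  have hC := catalan_cast_pos n
  set E := totalCount t n / catalan n with hE
  have hEn : |E - c * n| ≤ K := by
    have h1 : E - c * n = (totalCount t n - c * n * catalan n) / catalan n := by
      rw [hE]; field_simp
    rw [h1, abs_div, abs_of_pos hC, div_le_iff₀ hC]
    exact hmean n
  have hδn : ε * K + K ≤ δ * n := by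
    have : (ε * K + K) / δ ≤ n := by
      have : 0 ≤ K / c := by positivity
      linarith
    rw [div_le_iff₀ hδ0] at this
    linarith
  have hKn : K < c * n := by
    have : K / c < n := by
      have : 0 ≤ (ε * K + K) / δ := by positivity
      linarith
    rw [div_lt_iff₀ hc] at this
    linarith
  have hE0 : c * n - K ≤ E := by linarith [(abs_le.1 hEn).1]
  have hEpos : 0 < E := by linarith
  set S := (treesOfNumNodesEq n).filter fun T => ε ≤ |(treeCount t T : ℝ) / E - 1| with hS
  have hpt : ∀ T ∈ S, (δ * n) ^ 2 ≤ ((treeCount t T : ℝ) - c * T.numNodes) ^ 2 := by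
    intro T hT
    rw [hS, Finset.mem_filter, mem_treesOfNumNodesEq] at hT
    obtain ⟨hTn, hT⟩ := hT
    rw [hTn, ← sq_abs ((treeCount t T : ℝ) - c * n)]
    refine pow_le_pow_left₀ (by positivity) ?_ 2
    have h1 : (treeCount t T : ℝ) / E - 1 = (treeCount t T - E) / E := by field_simp
    rw [h1, abs_div, abs_of_pos hEpos, le_div_iff₀ hEpos] at hT
    have h2 : |(treeCount t T : ℝ) - E| ≤ |(treeCount t T : ℝ) - c * n| + |E - c * n| := by
      rw [abs_sub_comm E]
      exact abs_sub_le _ _ _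
    have h3 : ε * (c * n - K) ≤ ε * E := by gcongr
    have h4 : ε * (c * n) = 2 * (δ * n) := by rw [hδ]; ring
    nlinarith
  -- Chebyshev's inequality, with cardinalities in place of probabilities.
  have hcard : (S.card : ℝ) * (δ * n) ^ 2 ≤ B * 4 ^ n := by
    rw [← nsmul_eq_mul]
    refine (Finset.card_nsmul_le_sum S _ _ hpt).trans (le_trans ?_ (hsq n))
    exact Finset.sum_le_sum_of_subset_of_nonneg (Finset.filter_subset _ _)
      fun _ _ _ => sq_nonneg _
  have h4 := four_pow_le_sqrt_mul_catalan (n := n) (by omega)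
  have hs : 0 < √(n : ℝ) := Real.sqrt_pos.2 (by linarith)
  have hss : √(n : ℝ) * √(n : ℝ) = n := Real.mul_self_sqrt (by linarith)
  rw [div_le_div_iff₀ hC hs, div_mul_eq_mul_div, le_div_iff₀ (by positivity)]
  have h5 : B * 4 ^ n ≤ B * (2 * √n * ((n + n) * catalan n)) := by
    refine mul_le_mul_of_nonneg_left (h4.trans ?_) hB
    gcongr
  have h6 : (S.card : ℝ) * (δ * n) ^ 2 ≤ B * (2 * √n * ((n + n) * catalan n)) := hcard.trans h5
  have h7 : (S.card : ℝ) * √n * δ ^ 2 * (n * √n) ≤ 4 * B * catalan n * (n * √n) := by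
    calc (S.card : ℝ) * √n * δ ^ 2 * (n * √n) = S.card * δ ^ 2 * n * (√n * √n) := by ring
      _ = S.card * (δ * n) ^ 2 := by rw [hss]; ring
      _ ≤ _ := h6
      _ = _ := by ring
  exact le_of_mul_le_mul_right h7 (by positivity)

/-! ### Transfer from trees to 231-avoiding permutations -/

theorem mem_avoiding {m n : ℕ} {η : Equiv.Perm (Fin m)} {σ : Equiv.Perm (Fin n)} :
    σ ∈ avoiding η n ↔ ¬ ContainsPattern η σ := by
  simp [avoiding]

theorem containsPattern_p231_iff {n : ℕ} {σ : Equiv.Perm (Fin n)} :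
    ContainsPattern p231 σ ↔ ∃ i j m, i < j ∧ j < m ∧ σ m < σ i ∧ σ i < σ j := by
  constructor
  · rintro ⟨f, hf, h⟩
    exact ⟨f 0, f 1, f 2, hf (by decide), hf (by decide), (h 2 0).2 (by decide),
      (h 0 1).2 (by decide)⟩
  · rintro ⟨i, j, m, hij, hjm, h1, h2⟩
    refine ⟨![i, j, m], ?_, ?_⟩
    · rw [Fin.strictMono_iff_lt_succ]
      intro a
      fin_cases a
      · exact hij
      · exact hjm
    · have h3 := h1.trans h2
      intro a b
      fin_cases a <;> fin_cases b <;>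
        simp [p231, h1, h2, h3, h1.le, h2.le, h3.le]

theorem mem_avoiding_p231 {n : ℕ} {σ : Equiv.Perm (Fin n)} :
    σ ∈ avoiding p231 n ↔ ∀ i j m, i < j → j < m → σ m < σ i → ¬ σ i < σ j := by
  rw [mem_avoiding, containsPattern_p231_iff]
  push Not
  rfl

/-- The permutation encoded by a binary tree. -/
noncomputable def treePerm {n : ℕ} (T : BinaryTree Unit) (h : T.numNodes = n) :
    Equiv.Perm (Fin n) :=
  Equiv.ofBijective (fun i => ⟨treeVal T i, by
      have := treeVal_lt T i (by omega)
      omega⟩)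
    (Finite.injective_iff_bijective.1 fun i j hij =>
      Fin.ext (treeVal_injOn T i (by omega) j (by omega) (Fin.mk.inj_iff.1 hij)))

theorem treePerm_val {n : ℕ} (T : BinaryTree Unit) (h : T.numNodes = n) (i : Fin n) :
    (treePerm T h i : ℕ) = treeVal T i := rfl

theorem treePerm_mem_avoiding {n : ℕ} (T : BinaryTree Unit) (h : T.numNodes = n) :
    treePerm T h ∈ avoiding p231 n := by
  rw [mem_avoiding_p231]
  intro i j m hij hjm
  simp only [Fin.lt_def, treePerm_val] at *
  exact treeVal_avoids T i j m hij hjm (h ▸ m.2)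

theorem exists_eq_treePerm {n : ℕ} {σ : Equiv.Perm (Fin n)} (hσ : σ ∈ avoiding p231 n) :
    ∃ T, ∃ h : T.numNodes = n, σ = treePerm T h := by
  rw [mem_avoiding_p231] at hσ
  obtain ⟨T, h, hT⟩ := exists_tree_of_avoids n (fun i => if h : i < n then σ ⟨i, h⟩ else 0)
    (fun i hi => by simp [hi])
    (fun i hi j hj hij => by
      simp only [hi, hj, dif_pos] at hij
      exact Fin.mk.inj_iff.1 (σ.injective (Fin.ext hij)))
    (fun i j m hij hjm hm => by
      have hj := hjm.trans hm
      have hi := hij.trans hj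
      simp only [hi, hj, hm, dif_pos]
      exact hσ ⟨i, hi⟩ ⟨j, hj⟩ ⟨m, hm⟩ hij hjm)
  refine ⟨T, h, Equiv.ext fun i => Fin.ext ?_⟩
  rw [treePerm_val, ← hT i i.2]
  simp

theorem treePerm_inj {n : ℕ} {T T' : BinaryTree Unit} {h : T.numNodes = n} {h' : T'.numNodes = n}
    (e : treePerm T h = treePerm T' h') : T = T' :=
  eq_of_treeVal_eq T T' (h.trans h'.symm) fun i hi => by
    have := congrArg (fun σ : Equiv.Perm (Fin n) => (σ ⟨i, h ▸ hi⟩ : ℕ)) e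
    simpa only [treePerm_val] using this

theorem sum_avoiding_p231 {n : ℕ} {X : Equiv.Perm (Fin n) → ℝ} {Y : BinaryTree Unit → ℝ}
    (hXY : ∀ T (h : T.numNodes = n), X (treePerm T h) = Y T) :
    ∑ σ ∈ avoiding p231 n, X σ = ∑ T ∈ treesOfNumNodesEq n, Y T := by
  symm
  refine Finset.sum_bij (fun T hT => treePerm T (mem_treesOfNumNodesEq.1 hT))
    (fun T _ => treePerm_mem_avoiding T _) (fun T _ T' _ e => treePerm_inj e) ?_
    (fun T hT => (hXY T _).symm)
  intro σ hσ
  obtain ⟨T, h, rfl⟩ := exists_eq_treePerm hσ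
  exact ⟨T, mem_treesOfNumNodesEq.2 h, rfl⟩

theorem card_avoiding_p231 (n : ℕ) : (avoiding p231 n).card = catalan n := by
  have := sum_avoiding_p231 (n := n) (X := fun _ => 1) (Y := fun _ => 1) fun _ _ => rfl
  simp only [Finset.sum_const, nsmul_eq_mul, mul_one, treesOfNumNodesEq_card_eq_catalan] at this
  exact_mod_cast this

theorem prob_p231 {n : ℕ} {A : Equiv.Perm (Fin n) → Prop} {B : BinaryTree Unit → Prop}
    [DecidablePred B] (hAB : ∀ T (h : T.numNodes = n), A (treePerm T h) ↔ B T) :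
    prob p231 n A = (((treesOfNumNodesEq n).filter B).card : ℝ) / catalan n := by
  classical
  rw [prob, card_avoiding_p231, Finset.card_filter, Finset.card_filter]
  congr 1
  push_cast
  refine sum_avoiding_p231 fun T h => ?_
  simp only [hAB T h]

/-- The equality of sets is automatic once the values are prescribed, because `τ` is surjective. -/
theorem isPatternCluster_iff {n k : ℕ} {τ : Equiv.Perm (Fin k)} {σ : Equiv.Perm (Fin n)} {l s : ℕ} :
    IsPatternCluster τ σ l s ↔ l + k ≤ n ∧ s + k ≤ n ∧
      ∀ (i : Fin k) (p : Fin n), (p : ℕ) = s + i → (σ p : ℕ) = l + τ i := by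
  refine ⟨fun ⟨⟨h1, h2, _⟩, h⟩ => ⟨h1, h2, h⟩, fun ⟨h1, h2, h⟩ => ⟨⟨h1, h2, ?_⟩, h⟩⟩
  ext v
  simp only [Finset.mem_image, Finset.mem_filter, Finset.mem_univ, true_and]
  constructor
  · rintro ⟨p, ⟨h3, h4⟩, rfl⟩
    have := h ⟨p - s, by omega⟩ p (by simp only; omega)
    have := (τ ⟨p - s, by omega⟩).2
    omega
  · rintro ⟨h3, h4⟩
    set i := τ.symm ⟨v - l, by omega⟩ with hi
    have hτ : τ i = ⟨v - l, by omega⟩ := by rw [hi, Equiv.apply_symm_apply]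
    have := i.2
    refine ⟨⟨s + i, by omega⟩, ⟨by simp only; omega, by simp only; omega⟩, Fin.ext ?_⟩
    rw [h i ⟨s + i, by omega⟩ rfl, hτ]
    simp only
    omega

/-- The start `s` determines `l` (compare the first entries, which exist as `0 < k`), and `l + k ≤
n` follows from the maximum of `t`. So counting pairs amounts to counting starts. -/
theorem numPatternClusters_treePerm {n k : ℕ} {t T : BinaryTree Unit} (ht : t.numNodes = k)
    (hT : T.numNodes = n) (hk : 0 < k) :
    numPatternClusters (treePerm t ht) (treePerm T hT) = treeCount t T := by
  classical
  subst ht hT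
  rw [numPatternClusters, treeCount]
  have key : ∀ {l s}, IsPatternCluster (treePerm t rfl) (treePerm T rfl) l s →
      ∀ i < t.numNodes, treeVal T (s + i) = l + treeVal t i := by
    intro l s h i hi
    obtain ⟨h1, h2, h3⟩ := isPatternCluster_iff.1 h
    exact h3 ⟨i, hi⟩ ⟨s + i, by omega⟩ rfl
  refine Finset.card_bij (fun q _ => q.2) ?_ ?_ ?_
  · rintro ⟨l, s⟩ hq
    simp only [Finset.mem_filter, Finset.mem_product, Finset.mem_range] at hq ⊢
    exact ⟨hq.1.2, (isPatternCluster_iff.1 hq.2).2.1, l, key hq.2⟩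
  · rintro ⟨l, s⟩ hq ⟨l', s'⟩ hq' h
    simp only at h
    subst h
    have h1 := key (Finset.mem_filter.1 hq).2 0 hk
    have h2 := key (Finset.mem_filter.1 hq').2 0 hk
    simp only at h1 h2
    rw [Prod.mk.injEq]
    exact ⟨by omega, rfl⟩
  · intro s hs
    simp only [Finset.mem_filter, Finset.mem_range] at hs
    obtain ⟨hs1, hs2, l, hl⟩ := hs
    have hlk : l + t.numNodes ≤ T.numNodes := by
      obtain ⟨i, hi, h1⟩ := exists_treeVal_eq_pred t hk
      have := hl i hi
      have := treeVal_lt T (s + i) (by omega)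
      omega
    refine ⟨(l, s), ?_, rfl⟩
    simp only [Finset.mem_filter, Finset.mem_product, Finset.mem_range]
    refine ⟨⟨by omega, hs1⟩, isPatternCluster_iff.2 ⟨hlk, hs2, fun i p hp => ?_⟩⟩
    rw [treePerm_val, treePerm_val, hp]
    exact hl i i.2

theorem treePerm_rightComb (k : ℕ) (h : (rightComb k nil).numNodes = k) :
    treePerm (rightComb k nil) h = Fin.revPerm := by
  ext i
  rw [treePerm_val, treeVal_rightComb k nil i i.2]
  simp only [numNodes, Fin.revPerm_apply, Fin.val_rev]
  omega

/-- The part of the law of large numbers for clusters that concerns a fixed order of the cluster,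
together with the enumeration of the avoiding permutations. -/
def PatternClusterLaw (η : Equiv.Perm (Fin 3)) (k : ℕ) : Prop :=
  (∀ n, (avoiding η n).card = catalan n) ∧ tauStar η k ∈ avoiding η k ∧
  ∀ τ ∈ avoiding η k,
    (τ ≠ tauStar η k → ∀ n : ℕ, k ≤ n →
      expectation η n (fun σ => (numPatternClusters τ σ : ℝ)) =
        ((n : ℝ) - k + 2) * catalan (n - k + 1) / (2 * catalan n)) ∧
    (τ = tauStar η k → ∀ n : ℕ, k ≤ n →
      expectation η n (fun σ => (numPatternClusters τ σ : ℝ)) =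
        ((n : ℝ) - k + 3) * catalan (n - k + 2) / (2 * catalan n) -
          ((n : ℝ) - k + 2) * catalan (n - k + 1) / catalan n) ∧
    (∀ n : ℕ, k ≤ n → 0 < expectation η n (fun σ => (numPatternClusters τ σ : ℝ))) ∧
    TendstoInProb η (fun n σ => (numPatternClusters τ σ : ℝ) /
      expectation η n (fun ρ => (numPatternClusters τ ρ : ℝ))) 1

theorem patternClusterLaw_p231 {k : ℕ} (hk : 0 < k) : PatternClusterLaw p231 k := by
  have hrc : (rightComb k nil).numNodes = k := by simp [numNodes_rightComb]
  have hstar : tauStar p231 k = treePerm (rightComb k nil) hrc := by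
    rw [treePerm_rightComb, tauStar, if_pos (Or.inl rfl)]
  refine ⟨card_avoiding_p231, hstar ▸ treePerm_mem_avoiding _ _, fun τ hτ => ?_⟩
  obtain ⟨t, ht, rfl⟩ := exists_eq_treePerm hτ
  have hexp : ∀ n, expectation p231 n (fun σ => (numPatternClusters (treePerm t ht) σ : ℝ)) =
      totalCount t n / catalan n := by
    intro n
    rw [expectation, card_avoiding_p231, totalCount]
    congr 1
    exact sum_avoiding_p231 fun T hT => by rw [numPatternClusters_treePerm ht hT hk]
  have hiff : treePerm t ht = tauStar p231 k ↔ t = rightComb k nil := by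
    rw [hstar]
    exact ⟨treePerm_inj, fun h => by subst h; rfl⟩
  have hne : t ≠ rightComb k nil → ∀ m, totalCount t (k + m) = (Nat.centralBinom (m + 1) : ℝ) / 2 := by
    intro h m
    subst ht
    exact totalCount_of_ne hk h m
  have heq : t = rightComb k nil →
      ∀ m, totalCount t (k + m) = (Nat.centralBinom (m + 1) : ℝ) - catalan (m + 1) := by
    intro h m
    obtain ⟨j, rfl⟩ : ∃ j, k = j + 1 := ⟨k - 1, by omega⟩
    rw [h, totalCount_rightComb]
  refine ⟨fun h n hn => ?_, fun h n hn => ?_, fun n hn => ?_, fun ε hε => ?_⟩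
  · obtain ⟨m, rfl⟩ := Nat.exists_eq_add_of_le hn
    rw [hexp, hne (fun h' => h (hiff.2 h')), Nat.add_sub_cancel_left, centralBinom_eq]
    push_cast
    have := (catalan_cast_pos (k + m)).ne'
    field_simp
    ring
  · obtain ⟨m, rfl⟩ := Nat.exists_eq_add_of_le hn
    rw [hexp, heq (hiff.1 h), Nat.add_sub_cancel_left]
    have h1 := centralBinom_eq (m + 2)
    rw [centralBinom_succ_eq (m + 1)] at h1
    have h2 := centralBinom_eq (m + 1)
    push_cast at h1 h2 ⊢
    -- The Catalan ratio turns the claimed formula into a multiple of `catalan (m + 1)`, as `h2`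
    -- does for the computed total.
    have h3 : ((k : ℝ) + m - k + 3) * catalan (m + 2) = 2 * (2 * (m + 1) + 1) * catalan (m + 1) := by
      rw [h1]; ring
    rw [h2, h3]
    have := (catalan_cast_pos (k + m)).ne'
    field_simp
    ring
  · obtain ⟨m, rfl⟩ := Nat.exists_eq_add_of_le hn
    rw [hexp]
    refine div_pos ?_ (catalan_cast_pos _)
    have h1 := centralBinom_eq (m + 1)
    have h2 := catalan_cast_pos (m + 1)
    by_cases h : t = rightComb k nil
    · rw [heq h, h1]
      push_cast
      nlinarith [(Nat.cast_nonneg m : (0 : ℝ) ≤ m)]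
    · rw [hne h, h1]
      positivity
  · refine (tendsto_treeCount_ratio (ht ▸ hk) hε).congr fun n => ?_
    symm
    refine prob_p231 fun T hT => ?_
    simp only [hexp, numPatternClusters_treePerm ht hT hk]

/-! ### Reversal and complement -/

/-- A symmetry that preserves clusters transports the law from one pattern to another. -/
theorem PatternClusterLaw.transport {η η' : Equiv.Perm (Fin 3)} {k : ℕ}
    (φ : ∀ n, Equiv.Perm (Fin n) → Equiv.Perm (Fin n)) (hφ : ∀ n, Function.Involutive (φ n))
    (hav : ∀ n σ, φ n σ ∈ avoiding η' n ↔ σ ∈ avoiding η n)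
    (hpat : ∀ (n : ℕ) (τ : Equiv.Perm (Fin k)) (σ : Equiv.Perm (Fin n)),
      numPatternClusters (φ k τ) (φ n σ) = numPatternClusters τ σ)
    (hstar : φ k (tauStar η k) = tauStar η' k) (h : PatternClusterLaw η k) :
    PatternClusterLaw η' k := by
  classical
  have hsum : ∀ n (X : Equiv.Perm (Fin n) → ℝ),
      ∑ σ ∈ avoiding η' n, X σ = ∑ σ ∈ avoiding η n, X (φ n σ) := by
    intro n X
    refine Finset.sum_bij' (fun σ _ => φ n σ) (fun σ _ => φ n σ) ?_ ?_ ?_ ?_ ?_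
    · intro σ hσ
      rwa [← hav, hφ]
    · intro σ hσ
      rwa [hav]
    · intro σ _
      exact hφ n σ
    · intro σ _
      exact hφ n σ
    · intro σ _
      rw [hφ]
  have hcard : ∀ n, (avoiding η' n).card = (avoiding η n).card := by
    intro n
    have := hsum n fun _ => 1
    simp only [Finset.sum_const, nsmul_eq_mul, mul_one] at this
    exact_mod_cast this
  have hexp : ∀ n (τ : Equiv.Perm (Fin k)),
      expectation η' n (fun σ => (numPatternClusters (φ k τ) σ : ℝ)) =
        expectation η n (fun σ => (numPatternClusters τ σ : ℝ)) := by
    intro n τ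
    rw [expectation, expectation, hcard, hsum]
    simp only [hpat]
  obtain ⟨h1, h2, h3⟩ := h
  refine ⟨fun n => (hcard n).trans (h1 n), hstar ▸ (hav k _).2 h2, fun τ hτ => ?_⟩
  obtain ⟨τ, rfl⟩ := (hφ k).surjective τ
  have hinj : φ k τ = tauStar η' k ↔ τ = tauStar η k := by
    rw [← hstar]
    exact (hφ k).injective.eq_iff
  obtain ⟨a, b, c, d⟩ := h3 τ ((hav k τ).1 hτ)
  refine ⟨fun h n hn => ?_, fun h n hn => ?_, fun n hn => ?_, fun ε hε => ?_⟩
  · rw [hexp]; exact a (fun h' => h (hinj.2 h')) n hn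
  · rw [hexp]; exact b (hinj.1 h) n hn
  · rw [hexp]; exact c n hn
  · refine (d ε hε).congr fun n => ?_
    rw [prob, prob, hcard, Finset.card_filter, Finset.card_filter]
    push_cast
    rw [hsum]
    simp only [hpat, hexp]

/-- An inequality suffices, since the symmetries are involutions. Injectivity is required only in
the admissible range, where the reflections by `n - k` are not truncated. -/
theorem numPatternClusters_le_of_map {n k : ℕ} {τ τ' : Equiv.Perm (Fin k)}
    {σ σ' : Equiv.Perm (Fin n)} (f : ℕ × ℕ → ℕ × ℕ)
    (hf : ∀ l s, IsPatternCluster τ σ l s → IsPatternCluster τ' σ' (f (l, s)).1 (f (l, s)).2)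
    (hinj : Set.InjOn f {q | q.1 + k ≤ n ∧ q.2 + k ≤ n}) :
    numPatternClusters τ σ ≤ numPatternClusters τ' σ' := by
  classical
  refine Finset.card_le_card_of_injOn f ?_ ?_
  · rintro ⟨l, s⟩ hq
    have h := hf l s (Finset.mem_filter.1 hq).2
    have h' := isPatternCluster_iff.1 h
    simp only [Finset.coe_filter, Finset.mem_product, Finset.mem_range, Set.mem_ofPred_eq]
    exact ⟨⟨by omega, by omega⟩, h⟩
  · refine hinj.mono ?_
    rintro ⟨l, s⟩ hq
    have h' := isPatternCluster_iff.1 (Finset.mem_filter.1 hq).2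
    exact ⟨h'.1, h'.2.1⟩

theorem revPerm_mul_self (n : ℕ) : (Fin.revPerm : Equiv.Perm (Fin n)) * Fin.revPerm = 1 := by
  ext i; simp

theorem mul_revPerm_involutive (n : ℕ) :
    Function.Involutive fun σ : Equiv.Perm (Fin n) => σ * Fin.revPerm := fun σ => by
  simp only [mul_assoc, revPerm_mul_self, mul_one]

theorem revPerm_mul_involutive (n : ℕ) :
    Function.Involutive fun σ : Equiv.Perm (Fin n) => Fin.revPerm * σ := fun σ => by
  simp only [← mul_assoc, revPerm_mul_self, one_mul]

theorem ContainsPattern.mul_revPerm {m n : ℕ} {η : Equiv.Perm (Fin m)} {σ : Equiv.Perm (Fin n)}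
    (h : ContainsPattern η σ) : ContainsPattern (η * Fin.revPerm) (σ * Fin.revPerm) := by
  obtain ⟨f, hf, h⟩ := h
  refine ⟨fun i => Fin.rev (f (Fin.rev i)), fun i j hij => ?_, fun i j => ?_⟩
  · exact Fin.rev_lt_rev.2 (hf (Fin.rev_lt_rev.2 hij))
  · simpa using h (Fin.rev i) (Fin.rev j)

theorem ContainsPattern.revPerm_mul {m n : ℕ} {η : Equiv.Perm (Fin m)} {σ : Equiv.Perm (Fin n)}
    (h : ContainsPattern η σ) : ContainsPattern (Fin.revPerm * η) (Fin.revPerm * σ) := by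
  obtain ⟨f, hf, h⟩ := h
  exact ⟨f, hf, fun i j => by simpa using h j i⟩

theorem numPatternClusters_mul_revPerm_le {n k : ℕ} (τ : Equiv.Perm (Fin k))
    (σ : Equiv.Perm (Fin n)) :
    numPatternClusters τ σ ≤ numPatternClusters (τ * Fin.revPerm) (σ * Fin.revPerm) := by
  refine numPatternClusters_le_of_map (fun q => (q.1, n - k - q.2)) (fun l s h => ?_) ?_
  · obtain ⟨h1, h2, h3⟩ := isPatternCluster_iff.1 h
    refine isPatternCluster_iff.2 ⟨h1, by simp only; omega, fun i p hp => ?_⟩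
    refine h3 (Fin.rev i) (Fin.rev p) ?_
    simp only at hp
    rw [Fin.val_rev, Fin.val_rev]
    omega
  · rintro ⟨l, s⟩ ⟨_, h⟩ ⟨l', s'⟩ ⟨_, h'⟩ e
    simp only [Prod.mk.injEq] at e h h' ⊢
    omega

theorem numPatternClusters_revPerm_mul_le {n k : ℕ} (τ : Equiv.Perm (Fin k))
    (σ : Equiv.Perm (Fin n)) :
    numPatternClusters τ σ ≤ numPatternClusters (Fin.revPerm * τ) (Fin.revPerm * σ) := by
  refine numPatternClusters_le_of_map (fun q => (n - k - q.1, q.2)) (fun l s h => ?_) ?_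
  · obtain ⟨h1, h2, h3⟩ := isPatternCluster_iff.1 h
    refine isPatternCluster_iff.2 ⟨by simp only; omega, h2, fun i p hp => ?_⟩
    have h4 := h3 i p hp
    have h5 := (τ i).2
    simp only [Equiv.Perm.mul_apply, Fin.revPerm_apply, Fin.val_rev]
    omega
  · rintro ⟨l, s⟩ ⟨h, _⟩ ⟨l', s'⟩ ⟨h', _⟩ e
    simp only [Prod.mk.injEq] at e h h' ⊢
    omega

/-- The law for a pattern gives the law for the reversed pattern. -/
theorem PatternClusterLaw.mul_revPerm {η : Equiv.Perm (Fin 3)} {k : ℕ} (h : PatternClusterLaw η k)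
    (hstar : tauStar η k * Fin.revPerm = tauStar (η * Fin.revPerm) k) :
    PatternClusterLaw (η * Fin.revPerm) k := by
  have inv := mul_revPerm_involutive
  refine h.transport (fun n σ => σ * Fin.revPerm) inv (fun n σ => ?_) (fun n τ σ => ?_) hstar
  · rw [mem_avoiding, mem_avoiding, not_iff_not]
    refine ⟨fun h => ?_, fun h => h.mul_revPerm⟩
    have := h.mul_revPerm
    rwa [show η * Fin.revPerm * Fin.revPerm = η from inv 3 η,
      show σ * Fin.revPerm * Fin.revPerm = σ from inv n σ] at this
  · refine le_antisymm ?_ (numPatternClusters_mul_revPerm_le τ σ)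
    have := numPatternClusters_mul_revPerm_le (τ * Fin.revPerm) (σ * Fin.revPerm)
    rwa [show τ * Fin.revPerm * Fin.revPerm = τ from inv k τ,
      show σ * Fin.revPerm * Fin.revPerm = σ from inv n σ] at this

/-- The law for a pattern gives the law for the complementary pattern. -/
theorem PatternClusterLaw.revPerm_mul {η : Equiv.Perm (Fin 3)} {k : ℕ} (h : PatternClusterLaw η k)
    (hstar : Fin.revPerm * tauStar η k = tauStar (Fin.revPerm * η) k) :
    PatternClusterLaw (Fin.revPerm * η) k := by
  have inv := revPerm_mul_involutive
  refine h.transport (fun n σ => Fin.revPerm * σ) inv (fun n σ => ?_) (fun n τ σ => ?_) hstar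
  · rw [mem_avoiding, mem_avoiding, not_iff_not]
    refine ⟨fun h => ?_, fun h => h.revPerm_mul⟩
    have := h.revPerm_mul
    rwa [show Fin.revPerm * (Fin.revPerm * η) = η from inv 3 η,
      show Fin.revPerm * (Fin.revPerm * σ) = σ from inv n σ] at this
  · refine le_antisymm ?_ (numPatternClusters_revPerm_mul_le τ σ)
    have := numPatternClusters_revPerm_mul_le (Fin.revPerm * τ) (Fin.revPerm * σ)
    rwa [show Fin.revPerm * (Fin.revPerm * τ) = τ from inv k τ,
      show Fin.revPerm * (Fin.revPerm * σ) = σ from inv n σ] at this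

theorem patternClusterLaw {η : Equiv.Perm (Fin 3)}
    (hη : η = p132 ∨ η = p213 ∨ η = p231 ∨ η = p312) {k : ℕ} (hk : 0 < k) :
    PatternClusterLaw η k := by
  have h231 := patternClusterLaw_p231 hk
  have t231 : tauStar p231 k = Fin.revPerm := if_pos (Or.inl rfl)
  have t312 : tauStar p312 k = Fin.revPerm := if_pos (Or.inr rfl)
  have t132 : tauStar p132 k = 1 := if_neg (by decide)
  have t213 : tauStar p213 k = 1 := if_neg (by decide)
  -- 132 is the reverse of 231, 213 its complement, and 312 the complement of 132. Each symmetry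
  -- also exchanges the increasing and the decreasing `tauStar`.
  have e132 : p231 * Fin.revPerm = p132 := by decide
  have e213 : Fin.revPerm * p231 = p213 := by decide
  have e312 : Fin.revPerm * p132 = p312 := by decide
  have h132 : PatternClusterLaw p132 k := by
    rw [← e132]
    exact h231.mul_revPerm (by rw [e132, t231, t132, revPerm_mul_self])
  rcases hη with rfl | rfl | rfl | rfl
  · exact h132
  · rw [← e213]
    exact h231.revPerm_mul (by rw [e213, t231, t213, revPerm_mul_self])
  · exact h231
  · rw [← e312]
    exact h132.revPerm_mul (by rw [e312, t132, t312, mul_one])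

/-! ### Clusters of arbitrary order -/

/-- Every cluster has exactly one order of appearance. -/
theorem IsCluster.exists_isPatternCluster {n k : ℕ} {σ : Equiv.Perm (Fin n)} {l s : ℕ}
    (h : IsCluster k σ l s) : ∃ τ : Equiv.Perm (Fin k), IsPatternCluster τ σ l s := by
  have h0 := h
  obtain ⟨h1, h2, h3⟩ := h
  have hval : ∀ i : Fin k, l ≤ (σ ⟨s + i, by omega⟩ : ℕ) ∧ (σ ⟨s + i, by omega⟩ : ℕ) < l + k := by
    intro i
    have : σ ⟨s + i, by omega⟩ ∈
        Finset.univ.filter fun v : Fin n => l ≤ (v : ℕ) ∧ (v : ℕ) < l + k := by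
      rw [← h3]
      refine Finset.mem_image_of_mem _ ?_
      simp
    simpa using this
  let g : Fin k → Fin k := fun i =>
    ⟨(σ ⟨s + i, by omega⟩ : ℕ) - l, by have := hval i; omega⟩
  have hg : Function.Injective g := by
    intro i j hij
    have h4 := hval i
    have h5 := hval j
    have h6 : (σ ⟨s + i, by omega⟩ : ℕ) - l = (σ ⟨s + j, by omega⟩ : ℕ) - l := Fin.mk.inj_iff.1 hij
    have h7 : σ ⟨s + i, by omega⟩ = σ ⟨s + j, by omega⟩ := Fin.ext (by omega)
    have h8 := Fin.mk.inj_iff.1 (σ.injective h7)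
    exact Fin.ext (by omega)
  refine ⟨Equiv.ofBijective g (Finite.injective_iff_bijective.1 hg), h0, fun i p hp => ?_⟩
  have h4 := hval i
  have hp' : p = ⟨s + i, by omega⟩ := Fin.ext hp
  rw [hp']
  simp only [Equiv.ofBijective_apply, g]
  omega

theorem IsPatternCluster.unique {n k : ℕ} {τ τ' : Equiv.Perm (Fin k)} {σ : Equiv.Perm (Fin n)}
    {l s : ℕ} (h : IsPatternCluster τ σ l s) (h' : IsPatternCluster τ' σ l s) : τ = τ' := by
  have hs := h.1.2.1
  ext i
  have h1 := h.2 i ⟨s + i, by omega⟩ rfl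
  have h2 := h'.2 i ⟨s + i, by omega⟩ rfl
  omega

/-- A cluster of a permutation that avoids `η` has an order of appearance that avoids `η`. -/
theorem IsPatternCluster.mem_avoiding {m n k : ℕ} {η : Equiv.Perm (Fin m)} {τ : Equiv.Perm (Fin k)}
    {σ : Equiv.Perm (Fin n)} {l s : ℕ} (h : IsPatternCluster τ σ l s) (hσ : σ ∈ avoiding η n) :
    τ ∈ avoiding η k := by
  rw [PatternClusters.mem_avoiding] at hσ ⊢
  rintro ⟨f, hf, hfη⟩
  have hs := h.1.2.1
  refine hσ ⟨fun i => ⟨s + f i, by omega⟩, fun i j hij => ?_, fun i j => ?_⟩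
  · have := hf hij
    simp only [Fin.lt_def] at this ⊢
    omega
  · rw [← hfη, Fin.lt_def, Fin.lt_def, h.2 (f i) ⟨s + f i, by omega⟩ rfl,
      h.2 (f j) ⟨s + f j, by omega⟩ rfl]
    omega

/-- Clusters are partitioned by their order of appearance, which inherits avoidance from `σ`. -/
theorem numClusters_eq_sum {m n k : ℕ} {η : Equiv.Perm (Fin m)} {σ : Equiv.Perm (Fin n)}
    (hσ : σ ∈ avoiding η n) :
    numClusters k σ = ∑ τ ∈ avoiding η k, numPatternClusters τ σ := by
  classical
  simp only [numClusters, numPatternClusters]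
  rw [← Finset.card_biUnion]
  · congr 1
    ext q
    simp only [Finset.mem_biUnion, Finset.mem_filter]
    constructor
    · rintro ⟨hq, h⟩
      obtain ⟨τ, hτ⟩ := h.exists_isPatternCluster
      exact ⟨τ, hτ.mem_avoiding hσ, hq, hτ⟩
    · rintro ⟨τ, -, hq, hτ⟩
      exact ⟨hq, hτ.1⟩
  · intro τ _ τ' _ hne
    refine Finset.disjoint_left.2 fun q hq hq' => ?_
    exact hne ((Finset.mem_filter.1 hq).2.unique (Finset.mem_filter.1 hq').2)

theorem expectation_numClusters {m : ℕ} (η : Equiv.Perm (Fin m)) (n k : ℕ) :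
    expectation η n (fun σ => (numClusters k σ : ℝ)) =
      ∑ τ ∈ avoiding η k, expectation η n (fun σ => (numPatternClusters τ σ : ℝ)) := by
  simp only [expectation]
  rw [← Finset.sum_div, Finset.sum_comm]
  congr 1
  refine Finset.sum_congr rfl fun σ hσ => ?_
  rw [numClusters_eq_sum hσ]
  push_cast
  rfl

theorem prob_le_sum {m n : ℕ} {η : Equiv.Perm (Fin m)} {ι : Type*} {S : Finset ι}
    {A : Equiv.Perm (Fin n) → Prop} {B : ι → Equiv.Perm (Fin n) → Prop}
    (h : ∀ σ ∈ avoiding η n, A σ → ∃ i ∈ S, B i σ) :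
    prob η n A ≤ ∑ i ∈ S, prob η n (B i) := by
  classical
  simp only [prob]
  rw [← Finset.sum_div]
  gcongr
  have h1 : (avoiding η n).filter A ⊆ S.biUnion fun i => (avoiding η n).filter (B i) := by
    intro σ hσ
    rw [Finset.mem_filter] at hσ
    obtain ⟨i, hi, hB⟩ := h σ hσ.1 hσ.2
    exact Finset.mem_biUnion.2 ⟨i, hi, Finset.mem_filter.2 ⟨hσ.1, hB⟩⟩
  exact_mod_cast (Finset.card_le_card h1).trans Finset.card_biUnion_le

theorem PatternClusterLaw.expectation_numClusters_eq {η : Equiv.Perm (Fin 3)} {k : ℕ}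
    (h : PatternClusterLaw η k) {n : ℕ} (hn : k ≤ n) :
    expectation η n (fun σ => (numClusters k σ : ℝ)) =
      (catalan (n - k + 1) : ℝ) / (2 * catalan n) * (((n : ℝ) - k + 2) * catalan k + n - k) := by
  classical
  obtain ⟨h1, h2, h3⟩ := h
  -- One exceptional pattern plus `catalan k - 1` patterns with a common mean.
  rw [expectation_numClusters, ← Finset.add_sum_erase _ _ h2, (h3 _ h2).2.1 rfl n hn,
    Finset.sum_congr rfl fun τ hτ => (h3 τ (Finset.mem_of_mem_erase hτ)).1
      (Finset.ne_of_mem_erase hτ) n hn, Finset.sum_const, Finset.card_erase_of_mem h2, h1,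
    nsmul_eq_mul, Nat.cast_sub (by have := catalan_cast_pos k; exact_mod_cast this)]
  obtain ⟨m, rfl⟩ := Nat.exists_eq_add_of_le hn
  rw [Nat.add_sub_cancel_left]
  have h4 := centralBinom_eq (m + 2)
  rw [centralBinom_succ_eq (m + 1)] at h4
  push_cast at h4 ⊢
  have h5 : ((k : ℝ) + m - k + 3) * catalan (m + 2) = 2 * (2 * (m + 1) + 1) * catalan (m + 1) := by
    rw [h4]; ring
  rw [h5]
  have := (catalan_cast_pos (k + m)).ne'
  field_simp
  ring

/-- If every `numPatternClusters τ` is within relative error `ε` of its positive mean, so is their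
sum. A union bound over the finite set of `τ` finishes. -/
theorem PatternClusterLaw.tendstoInProb_numClusters {η : Equiv.Perm (Fin 3)} {k : ℕ}
    (h : PatternClusterLaw η k) :
    TendstoInProb η (fun n σ => (numClusters k σ : ℝ) /
      expectation η n (fun ρ => (numClusters k ρ : ℝ))) 1 := by
  intro ε hε
  obtain ⟨_, h2, h3⟩ := h
  have hlim := tendsto_finsetSum (avoiding η k) fun τ hτ => (h3 τ hτ).2.2.2 ε hε
  rw [Finset.sum_const_zero] at hlim
  refine squeeze_zero' (Eventually.of_forall fun n => by unfold prob; positivity) ?_ hlim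
  filter_upwards [eventually_ge_atTop k] with n hn
  refine prob_le_sum fun σ hσ hA => ?_
  by_contra! hcon
  have hpos : ∀ τ ∈ avoiding η k,
      0 < expectation η n (fun ρ => (numPatternClusters τ ρ : ℝ)) := fun τ hτ => (h3 τ hτ).2.2.1 n hn
  have hE : 0 < expectation η n (fun ρ => (numClusters k ρ : ℝ)) := by
    rw [expectation_numClusters]
    exact Finset.sum_pos hpos ⟨_, h2⟩
  have rescale : ∀ x E : ℝ, 0 < E → |x / E - 1| = |x - E| / E := fun x E hE => by
    rw [← abs_of_pos hE, ← abs_div, abs_of_pos hE, sub_div, div_self hE.ne']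
  rw [rescale _ _ hE, le_div_iff₀ hE, expectation_numClusters, numClusters_eq_sum hσ] at hA
  push_cast at hA
  rw [← Finset.sum_sub_distrib, Finset.mul_sum] at hA
  refine absurd (hA.trans (Finset.abs_sum_le_sum_abs _ _)) (not_le.2 ?_)
  refine Finset.sum_lt_sum_of_nonempty ⟨_, h2⟩ fun τ hτ => ?_
  have := hcon τ hτ
  rwa [rescale _ _ (hpos τ hτ), div_lt_iff₀ (hpos τ hτ)] at this

end PatternClusters

theorem mainTheorem1 (η : Equiv.Perm (Fin 3))
    (hη : η = PatternClusters.p132 ∨ η = PatternClusters.p213 ∨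
      η = PatternClusters.p231 ∨ η = PatternClusters.p312)
    (k : ℕ) (hk : 2 ≤ k) :
    PatternClusters.tauStar η k ∈ PatternClusters.avoiding η k ∧
    (∀ τ ∈ PatternClusters.avoiding η k,
      (τ ≠ PatternClusters.tauStar η k → ∀ n : ℕ, k ≤ n →
        PatternClusters.expectation η n
            (fun σ => (PatternClusters.numPatternClusters τ σ : ℝ)) =
          ((n : ℝ) - k + 2) * catalan (n - k + 1) / (2 * catalan n)) ∧
      (τ = PatternClusters.tauStar η k → ∀ n : ℕ, k ≤ n →
        PatternClusters.expectation η n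
            (fun σ => (PatternClusters.numPatternClusters τ σ : ℝ)) =
          ((n : ℝ) - k + 3) * catalan (n - k + 2) / (2 * catalan n) -
            ((n : ℝ) - k + 2) * catalan (n - k + 1) / catalan n) ∧
      PatternClusters.TendstoInProb η
        (fun n σ => (PatternClusters.numPatternClusters τ σ : ℝ) /
          PatternClusters.expectation η n
            (fun ρ => (PatternClusters.numPatternClusters τ ρ : ℝ))) 1) ∧
    (∀ n : ℕ, k ≤ n →
      PatternClusters.expectation η n (fun σ => (PatternClusters.numClusters k σ : ℝ)) =
        (catalan (n - k + 1) : ℝ) / (2 * catalan n) *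
          (((n : ℝ) - k + 2) * catalan k + n - k)) ∧
    PatternClusters.TendstoInProb η
      (fun n σ => (PatternClusters.numClusters k σ : ℝ) /
        PatternClusters.expectation η n
          (fun ρ => (PatternClusters.numClusters k ρ : ℝ))) 1 := by
  have h := PatternClusters.patternClusterLaw hη (k := k) (by omega)
  exact ⟨h.2.1, fun τ hτ => ⟨(h.2.2 τ hτ).1, (h.2.2 τ hτ).2.1, (h.2.2 τ hτ).2.2.2⟩,
    fun n hn => h.expectation_numClusters_eq hn, h.tendstoInProb_numClusters⟩
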